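/- Let $d\ge 1$, let $x\sim y$ mean $|x-y|=1$ for $x,y\in\mathbb Z^d$, and let $E$ be the set of edges $\langle x,y\rangle$ (unordered pairs with $x\sim y$). Let $q>1$ and $p=2q/(q-1)$. Let $w:\mathbb Z^d\to(0,1]$ satisfy $\sum_x w(x)<\infty$ and, for some $w_0>0$, $w(x)\le w_0\,w(y)$ whenever $x\sim y$. Put $$\mathcal S_p=\Big\{\sigma\in\mathbb R^{\mathbb Z^d}:\sum_x|\sigma(x)|^p w(x)<\infty\Big\},\qquad \|J\|_q=\Big(\sum_{\langle x,y\rangle\in E}|J_{xy}|^q[w(x)+w(y)]\Big)^{1/q},$$ and $\mathcal J_q=\{J\in\mathbb R^{E}:\|J\|_q<\infty\}$, equipped with its norm topology and Borel $\sigma$-field. Let $\nu$ be a probability measure on $\mathcal J_q$. Let $\chi=(\chi_x)_{x\in\mathbb Z^d}$ be probability measures on $\mathbb R$ such that, for every $\lambda>0$, $\sup_x\int e^{\lambda|u|^{p}}\chi_x(du)<\infty$ and $\inf_x\int e^{-\lambda|u|^{p}}\chi_x(du)>0$. For a finite non-empty $\Delta\subset\mathbb Z^d$, $J\in\mathcal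 J_q$ and $\xi\in\mathbb R^{\mathbb Z^d}$ let $$-H_\Delta(\sigma_\Delta|J,\xi)=\sum_{\langle x,y\rangle\in E,\ x,y\in\Delta}J_{xy}\sigma(x)\sigma(y)+\sum_{x\in\Delta,\ y\in\Delta^c,\ x\sim y}J_{xy}\sigma(x)\xi(y),$$ and let $\pi_\Delta(\cdot|J,\xi)$ be the image of the probability measure $Z_\Delta(J,\xi)^{-1}e^{-H_\Delta(\sigma_\Delta|J,\xi)}\prod_{x\in\Delta}\chi_x(d\sigma(x))$ on $\mathbb R^\Delta$ under the map $\sigma_\Delta\mapsto\sigma_\Delta\times\xi_{\Delta^c}$ (the configuration equal to $\sigma$ on $\Delta$ and to $\xi$ on $\Delta^c$). Let $\mathcal P(\mathbb R^{\mathbb Z^d})$ be the space of probability measures on $\mathbb R^{\mathbb Z^d}$ (product topology) and $\mathfrak P$ the space of probability measures on $\mathcal P(\mathbb R^{\mathbb Z^d})$, both with the weak topology and its Borel $\sigma$-field. Let $\mathcal G_p(J)$ be the set of all $\mu\in\mathcal P(\mathbb R^{\mathbb Z^d})$ with $\mu(\mathcal S_p)=1$ and $\int\pi_\Delta(A|J,\eta)\,\mu(d\eta)=\mu(A)$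 for all finite non-empty $\Delta$ and all Borel $A$. A random Gibbs measure is a measurable map $\mu:\mathcal J_q\to\mathcal P(\mathbb R^{\mathbb Z^d})$ with $\mu(J)\in\mathcal G_p(J)$ for $\nu$-almost all $J$. An Aizenman–Wehr metastate is a measurable map $\mathfrak m:\mathcal J_q\to\mathfrak P$ such that (a) $\mathfrak m(J)(\mathcal G_p(J))=1$ for $\nu$-almost all $J$, and (b) the map $J\mapsto\int\mu\,\mathfrak m(J)(d\mu)$ is a random Gibbs measure, the integral being understood by pairing with bounded continuous functions on $\mathbb R^{\mathbb Z^d}$. A cofinal sequence is a sequence $(\Delta_n)_{n\ge1}$ of finite non-empty subsets of $\mathbb Z^d$ that is increasing with respect to inclusion and such that every $x\in\mathbb Z^d$ belongs to some $\Delta_n$. **Theorem.** For every $\xi\in\mathcal S_p$ there exist an Aizenman–Wehr metastate $\mathfrak m^\xi$ and a cofinal sequence $(\Delta_n)_{n\ge1}$ such that, for $\nu$-almost all $J\in\mathcal J_q$, the Newman–Stein empirical metastates $\frac1N\sum_{n=1}^N\delta_{\pi_{\Delta_n}(\cdot|J,\xi)}$ converge to $\mathfrak m^\xi(J)$ in $\mathfrak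 P$ (i.e. weakly) as $N\to\infty$. -/

import Mathlib

open MeasureTheory Filter Topology
open scoped BoundedContinuousFunction ENNReal

noncomputable section

namespace LatticeSpin

/-- The lattice `ℤ^d`. -/
abbrev Site (d : ℕ) : Type := Fin d → ℤ

/-- Spin configurations, i.e. `ℝ^{ℤ^d}` with the product topology and the product (= Borel)
`σ`-field. -/
abbrev Config (d : ℕ) : Type := Site d → ℝ

/-- The nearest-neighbour graph: `x ∼ y` iff `|x - y| = 1`. (On integer vectors the Euclidean and
the `ℓ¹` norm equal `1` for the same vectors.) -/
def lattice (d : ℕ) : SimpleGraph (Site d) where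
  Adj x y := ∑ i, |x i - y i| = 1
  symm := ⟨fun x y h => by simpa only [abs_sub_comm] using h⟩
  loopless := ⟨fun x h => by simp at h⟩

/-- Every site has finitely many neighbours. -/
theorem lattice_neighborSet_finite {d : ℕ} (x : Site d) :
    ((lattice d).neighborSet x).Finite := by
  refine (Set.finite_Icc (x - 1) (x + 1)).subset fun y hy => ?_
  have hy' : ∑ i, |x i - y i| = 1 := hy
  have h (i : Fin d) : |x i - y i| ≤ 1 :=
    hy' ▸ Finset.single_le_sum (f := fun i => |x i - y i|) (fun j _ => abs_nonneg _)
      (Finset.mem_univ i)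
  constructor <;> intro i <;> have := abs_le.1 (h i) <;> simp <;> linarith

/-- The edges `⟨x, y⟩` of the nearest-neighbour graph (unordered pairs). -/
abbrev Edge (d : ℕ) : Type := (lattice d).edgeSet

/-- A weight function `w : ℤ^d → (0, 1]`. -/
structure IsWeight {d : ℕ} (w : Site d → ℝ) : Prop where
  pos : ∀ x, 0 < w x
  le_one : ∀ x, w x ≤ 1
  summable : Summable w
  exists_le_mul : ∃ w₀ : ℝ, 0 < w₀ ∧ ∀ x y, (lattice d).Adj x y → w x ≤ w₀ * w y

/-- `w(x) + w(y)` for the edge `⟨x, y⟩`. -/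
def edgeWeight {d : ℕ} (w : Site d → ℝ) (e : Edge d) : ℝ :=
  Sym2.lift ⟨fun x y => w x + w y, fun x y => add_comm (w x) (w y)⟩ e.1

/-- The space `𝒮_p = L^p(ℤ^d, w)` of tempered configurations. -/
def tempered {d : ℕ} (p : ℝ) (w : Site d → ℝ) : Set (Config d) :=
  {σ | Summable fun x => |σ x| ^ p * w x}

/-- The space `𝒥_q = L^q(E, w)` of tempered interaction intensities. -/
def Couplings {d : ℕ} (q : ℝ) (w : Site d → ℝ) : Type :=
  {J : Edge d → ℝ // Summable fun e => |J e| ^ q * edgeWeight w e}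

namespace Couplings

variable {d : ℕ} {q : ℝ} {w : Site d → ℝ}

instance : CoeFun (Couplings q w) (fun _ => Edge d → ℝ) := ⟨Subtype.val⟩

/-- The distance `‖J - K‖_q` of the weighted `L^q` norm. -/
def normDist (J K : Couplings q w) : ℝ :=
  (∑' e, |J e - K e| ^ q * edgeWeight w e) ^ (1 / q)

/-- The norm topology of `𝒥_q`, generated by the open norm balls. -/
instance : TopologicalSpace (Couplings q w) :=
  TopologicalSpace.generateFrom
    {B | ∃ (J : Couplings q w) (r : ℝ), B = {K | normDist J K < r}}

instance : MeasurableSpace (Couplings q w) := borel _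

instance : BorelSpace (Couplings q w) := ⟨rfl⟩

end Couplings

/-- `𝒫(ℝ^{ℤ^d})` with the weak topology and the Borel `σ`-field of that topology. -/
def State (d : ℕ) : Type := ProbabilityMeasure (Config d)

instance (d : ℕ) : TopologicalSpace (State d) :=
  inferInstanceAs (TopologicalSpace (ProbabilityMeasure (Config d)))

instance (d : ℕ) : MeasurableSpace (State d) := borel _

instance (d : ℕ) : BorelSpace (State d) := ⟨rfl⟩

/-- The measure underlying an element of `𝒫(ℝ^{ℤ^d})`. -/
def State.toMeasure {d : ℕ} (μ : State d) : Measure (Config d) :=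
  ProbabilityMeasure.toMeasure (Ω := Config d) μ

/-- The space `𝔓` of probability measures on `𝒫(ℝ^{ℤ^d})`, with the weak topology and the
Borel `σ`-field of that topology. -/
def StateLaw (d : ℕ) : Type := ProbabilityMeasure (State d)

instance (d : ℕ) : TopologicalSpace (StateLaw d) :=
  inferInstanceAs (TopologicalSpace (ProbabilityMeasure (State d)))

instance (d : ℕ) : MeasurableSpace (StateLaw d) := borel _

instance (d : ℕ) : BorelSpace (StateLaw d) := ⟨rfl⟩

/-- The measure underlying an element of `𝔓`. -/
def StateLaw.toMeasure {d : ℕ} (m : StateLaw d) : Measure (State d) :=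
  ProbabilityMeasure.toMeasure (Ω := State d) m

/-- The class `𝒦_q` of families of single-spin measures: `C₊(λ) < ∞` and `C₋(λ) > 0` for
all `λ > 0`. -/
def SingleSpinClass {d : ℕ} (q : ℝ) (χ : Site d → ProbabilityMeasure ℝ) : Prop :=
  ∀ a : ℝ, 0 < a →
    (⨆ x, ∫⁻ u, ENNReal.ofReal (Real.exp (a * |u| ^ (2 * q / (q - 1)))) ∂(χ x : Measure ℝ)) < ∞ ∧
    0 < ⨅ x, ∫⁻ u, ENNReal.ofReal (Real.exp (-(a * |u| ^ (2 * q / (q - 1))))) ∂(χ x : Measure ℝ)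

/-- The configuration `σ_Δ × ξ_{Δᶜ}`. -/
def glue {d : ℕ} (Δ : Finset (Site d)) (ξ : Config d) (σ : Δ → ℝ) : Config d :=
  fun x => if h : x ∈ Δ then σ ⟨x, h⟩ else ξ x

theorem measurable_glue {d : ℕ} (Δ : Finset (Site d)) (ξ : Config d) :
    Measurable (glue Δ ξ) := by
  refine measurable_pi_lambda _ fun x => ?_
  unfold glue
  split_ifs with h
  · exact measurable_pi_apply _
  · exact measurable_const

open Classical in
/-- The intensity `J_e`; only used when `e` is an edge, and set to `0` otherwise. -/
def coupling {d : ℕ} (J : Edge d → ℝ) (e : Sym2 (Site d)) : ℝ :=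
  if h : e ∈ (lattice d).edgeSet then J ⟨e, h⟩ else 0

open Classical in
/-- `-H_Δ(σ_Δ | J, ξ)`: the sum over the edges with both endpoints in `Δ`, plus the sum over the
pairs `x ∈ Δ`, `y ∉ Δ` with `x ∼ y`. -/
def negEnergy {d : ℕ} (Δ : Finset (Site d)) (J : Edge d → ℝ) (ξ : Config d) (σ : Δ → ℝ) : ℝ :=
  (∑ e ∈ Δ.sym2 with e ∈ (lattice d).edgeSet, coupling J e * (e.map (glue Δ ξ σ)).mul) +
  ∑ x ∈ Δ, ∑ y ∈ (lattice_neighborSet_finite x).toFinset \ Δ,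
    coupling J s(x, y) * glue Δ ξ σ x * ξ y

/-- The local Gibbs kernel `π_Δ(· | J, ξ)`: the image under `σ_Δ ↦ σ_Δ × ξ_{Δᶜ}` of the measure
`Z_Δ(J, ξ)⁻¹ exp(-H_Δ(σ_Δ | J, ξ)) χ_Δ(dσ_Δ)`, with `χ_Δ` the product measure. -/
def gibbsKernel {d : ℕ} (χ : Site d → ProbabilityMeasure ℝ) (Δ : Finset (Site d))
    (J : Edge d → ℝ) (ξ : Config d) : Measure (Config d) :=
  ((Measure.pi fun x : Δ => (χ x : Measure ℝ)).tilted (negEnergy Δ J ξ)).map (glue Δ ξ)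

theorem measurable_negEnergy {d : ℕ} (Δ : Finset (Site d)) (J : Edge d → ℝ) (ξ : Config d) :
    Measurable (negEnergy Δ J ξ) := by
  have hg (x : Site d) : Measurable fun σ : Δ → ℝ => glue Δ ξ σ x :=
    (measurable_pi_apply x).comp (measurable_glue Δ ξ)
  unfold negEnergy
  refine (Finset.measurable_sum _ fun e _ => ?_).add
    (Finset.measurable_sum _ fun x _ => Finset.measurable_sum _ fun y _ => ?_)
  · induction e using Sym2.ind with
    | _ x y =>
      simp only [Sym2.map_mk, Sym2.mul_mk]
      exact ((hg x).mul (hg y)).const_mul _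
  · exact ((hg x).const_mul _).mul_const _

theorem exists_negEnergy_le {d : ℕ} (Δ : Finset (Site d)) (J : Edge d → ℝ) (ξ : Config d) :
    ∃ C : ℝ, 0 < C ∧ ∀ σ : Δ → ℝ, negEnergy Δ J ξ σ ≤ C * (1 + ∑ x, σ x ^ 2) := by
  classical
  let C₁ : ℝ := ∑ e ∈ Δ.sym2 with e ∈ (lattice d).edgeSet, |coupling J e|
  let C₂ : ℝ := ∑ x ∈ Δ, ∑ y ∈ (lattice_neighborSet_finite x).toFinset \ Δ,
    |coupling J s(x, y) * ξ y|
  have h1 : 0 ≤ C₁ := Finset.sum_nonneg fun _ _ => abs_nonneg _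
  have h2 : 0 ≤ C₂ := Finset.sum_nonneg fun _ _ => Finset.sum_nonneg fun _ _ => abs_nonneg _
  refine ⟨C₁ + C₂ + 1, by linarith, fun σ => ?_⟩
  set S : ℝ := ∑ x, σ x ^ 2 with hS
  have hS0 : 0 ≤ S := Finset.sum_nonneg fun _ _ => sq_nonneg _
  have hle (x : Site d) (hx : x ∈ Δ) : glue Δ ξ σ x ^ 2 ≤ S := by
    simp only [glue, hx, dite_true]
    exact Finset.single_le_sum (f := fun x => σ x ^ 2) (fun j _ => sq_nonneg _)
      (Finset.mem_univ _)
  have e1 : (∑ e ∈ Δ.sym2 with e ∈ (lattice d).edgeSet,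
      coupling J e * (e.map (glue Δ ξ σ)).mul) ≤ C₁ * (1 + S) := by
    rw [Finset.sum_mul]
    refine Finset.sum_le_sum fun e he => ?_
    have he' := (Finset.mem_filter.1 he).1
    induction e using Sym2.ind with
    | _ x y =>
      rw [Finset.mk_mem_sym2_iff] at he'
      have hx := hle x he'.1
      have hy := hle y he'.2
      rw [Sym2.map_mk, Sym2.mul_mk]
      refine (le_abs_self _).trans ?_
      rw [abs_mul]
      refine mul_le_mul_of_nonneg_left ?_ (abs_nonneg _)
      rw [abs_le]
      constructor <;> nlinarith [sq_nonneg (glue Δ ξ σ x - glue Δ ξ σ y),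
        sq_nonneg (glue Δ ξ σ x + glue Δ ξ σ y)]
  have e2 : (∑ x ∈ Δ, ∑ y ∈ (lattice_neighborSet_finite x).toFinset \ Δ,
      coupling J s(x, y) * glue Δ ξ σ x * ξ y) ≤ C₂ * (1 + S) := by
    rw [Finset.sum_mul]
    refine Finset.sum_le_sum fun x hx => ?_
    rw [Finset.sum_mul]
    refine Finset.sum_le_sum fun y _ => ?_
    have hx := hle x hx
    refine (le_abs_self _).trans ?_
    rw [mul_right_comm, abs_mul]
    refine mul_le_mul_of_nonneg_left ?_ (abs_nonneg _)
    rw [abs_le]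
    constructor <;> nlinarith [sq_nonneg (glue Δ ξ σ x - 1), sq_nonneg (glue Δ ξ σ x + 1)]
  have : negEnergy Δ J ξ σ ≤ C₁ * (1 + S) + C₂ * (1 + S) := add_le_add e1 e2
  nlinarith

theorem integrable_exp_sq {d : ℕ} {q : ℝ} (hq : 1 < q) {χ : Site d → ProbabilityMeasure ℝ}
    (hχ : SingleSpinClass q χ) (x : Site d) {C : ℝ} (hC : 0 < C) :
    Integrable (fun u : ℝ => Real.exp (C * u ^ 2)) (χ x : Measure ℝ) := by
  have hp : 2 ≤ 2 * q / (q - 1) := by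
    rw [le_div_iff₀ (by linarith)]; linarith
  have hfin : ∫⁻ u, ENNReal.ofReal (Real.exp (C * |u| ^ (2 * q / (q - 1)))) ∂(χ x : Measure ℝ)
      < ∞ := (le_iSup (fun x => ∫⁻ u, ENNReal.ofReal
        (Real.exp (C * |u| ^ (2 * q / (q - 1)))) ∂(χ x : Measure ℝ)) x).trans_lt (hχ C hC).1
  have hint : Integrable (fun u : ℝ => Real.exp (C * |u| ^ (2 * q / (q - 1))))
      (χ x : Measure ℝ) := by
    refine ⟨Measurable.aestronglyMeasurable (by fun_prop), ?_⟩
    rw [hasFiniteIntegral_iff_ofReal (Eventually.of_forall fun u => (Real.exp_pos _).le)]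
    exact hfin
  refine (hint.const_mul (Real.exp C)).mono' (by fun_prop) (Eventually.of_forall fun u => ?_)
  rw [Real.norm_of_nonneg (Real.exp_pos _).le, ← Real.exp_add, Real.exp_le_exp]
  have key : u ^ 2 ≤ 1 + |u| ^ (2 * q / (q - 1)) := by
    rcases le_total |u| 1 with h | h
    · have h0 : 0 ≤ |u| ^ (2 * q / (q - 1)) := Real.rpow_nonneg (abs_nonneg _) _
      nlinarith [sq_abs u, abs_nonneg u]
    · have := Real.rpow_le_rpow_of_exponent_le h hp
      rw [Real.rpow_two, sq_abs] at this
      linarith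
  nlinarith

theorem integrable_exp_negEnergy {d : ℕ} {q : ℝ} (hq : 1 < q)
    {χ : Site d → ProbabilityMeasure ℝ} (hχ : SingleSpinClass q χ) (Δ : Finset (Site d))
    (J : Edge d → ℝ) (ξ : Config d) :
    Integrable (fun σ => Real.exp (negEnergy Δ J ξ σ))
      (Measure.pi fun x : Δ => (χ x : Measure ℝ)) := by
  obtain ⟨C, hC, hle⟩ := exists_negEnergy_le Δ J ξ
  have h := (Integrable.fintype_prod (f := fun (_ : Δ) (u : ℝ) => Real.exp (C * u ^ 2))
    (μ := fun x : Δ => (χ x : Measure ℝ))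
    (fun x => integrable_exp_sq hq hχ x hC)).const_mul (Real.exp C)
  refine h.mono' (Real.measurable_exp.comp (measurable_negEnergy Δ J ξ)).aestronglyMeasurable
    (Eventually.of_forall fun σ => ?_)
  rw [Real.norm_of_nonneg (Real.exp_pos _).le, ← Real.exp_sum, ← Real.exp_add, Real.exp_le_exp,
    ← Finset.mul_sum]
  linarith [hle σ]

theorem isProbabilityMeasure_gibbsKernel {d : ℕ} {q : ℝ} (hq : 1 < q)
    {χ : Site d → ProbabilityMeasure ℝ} (hχ : SingleSpinClass q χ) (Δ : Finset (Site d))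
    (J : Edge d → ℝ) (ξ : Config d) : IsProbabilityMeasure (gibbsKernel χ Δ J ξ) := by
  have := isProbabilityMeasure_tilted (integrable_exp_negEnergy hq hχ Δ J ξ)
  exact Measure.isProbabilityMeasure_map (measurable_glue Δ ξ).aemeasurable

/-- The kernel `π_Δ(· | J, ξ)` as a point of `𝒫(ℝ^{ℤ^d})`. -/
def localGibbs {d : ℕ} {q : ℝ} (hq : 1 < q) {χ : Site d → ProbabilityMeasure ℝ}
    (hχ : SingleSpinClass q χ) (Δ : Finset (Site d)) (J : Edge d → ℝ) (ξ : Config d) : State d :=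
  (⟨gibbsKernel χ Δ J ξ, isProbabilityMeasure_gibbsKernel hq hχ Δ J ξ⟩ :
    ProbabilityMeasure (Config d))

/-- The set `𝒢_p(J)` of tempered Gibbs measures: the tempered solutions of the DLR equation. -/
def gibbsStates {d : ℕ} (p : ℝ) (w : Site d → ℝ) (χ : Site d → ProbabilityMeasure ℝ)
    (J : Edge d → ℝ) : Set (State d) :=
  {μ | μ.toMeasure (tempered p w) = 1 ∧
    ∀ Δ : Finset (Site d), Δ.Nonempty → ∀ A : Set (Config d), MeasurableSet A →
      ∫⁻ η, gibbsKernel χ Δ J η A ∂μ.toMeasure = μ.toMeasure A}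

/-- Random Gibbs measures: measurable maps with `μ(J) ∈ 𝒢_p(J)` for `ν`-almost all `J`. -/
def IsRandomGibbs {d : ℕ} {q : ℝ} {w : Site d → ℝ} (p : ℝ) (χ : Site d → ProbabilityMeasure ℝ)
    (ν : Measure (Couplings q w)) (μ : Couplings q w → State d) : Prop :=
  Measurable μ ∧ ∀ᵐ J : Couplings q w ∂ν, μ J ∈ gibbsStates p w χ J

/-- Aizenman-Wehr metastates. The last clause says that the barycentre map
`J ↦ ∫ μ 𝔪(J)(dμ)`, the integral being understood by pairing with bounded continuous functions,
is a random Gibbs measure. -/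
def IsMetastate {d : ℕ} {q : ℝ} {w : Site d → ℝ} (p : ℝ) (χ : Site d → ProbabilityMeasure ℝ)
    (ν : Measure (Couplings q w)) (m : Couplings q w → StateLaw d) : Prop :=
  Measurable m ∧
  (∀ᵐ J : Couplings q w ∂ν, (m J).toMeasure (gibbsStates p w χ J) = 1) ∧
  ∃ b : Couplings q w → State d,
    (∀ (J : Couplings q w) (f : Config d →ᵇ ℝ),
      ∫ σ, f σ ∂(b J).toMeasure = ∫ μ : State d, (∫ σ, f σ ∂μ.toMeasure) ∂(m J).toMeasure) ∧
    IsRandomGibbs p χ ν b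

/-- Cofinal sequences of finite non-empty sets of sites: increasing and exhausting. -/
structure IsCofinalSeq {d : ℕ} (D : ℕ → Finset (Site d)) : Prop where
  nonempty : ∀ n, (D n).Nonempty
  mono : Monotone D
  exhausting : ∀ x, ∃ n, x ∈ D n

theorem isProbabilityMeasure_average {Ω : Type*} [MeasurableSpace Ω] (s : ℕ → Ω) (N : ℕ) :
    IsProbabilityMeasure
      ((N + 1 : ℝ≥0∞)⁻¹ • ∑ n ∈ Finset.range (N + 1), Measure.dirac (s n)) := by
  constructor
  simp only [Measure.smul_apply, Measure.coe_finsetSum, Finset.sum_apply, measure_univ,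
    Finset.sum_const, Finset.card_range, smul_eq_mul, nsmul_eq_mul, mul_one, Nat.cast_add,
    Nat.cast_one]
  exact ENNReal.inv_mul_cancel (by simp) (by finiteness)

/-- The Newman-Stein empirical metastate of the first `N + 1` members of the sequence
`D 0, D 1, …`, i.e. `(N + 1)⁻¹ ∑_{n ≤ N} δ_{π_{D n}(· | J, ξ)}`. -/
def empiricalMetastate {d : ℕ} {q : ℝ} (hq : 1 < q) {χ : Site d → ProbabilityMeasure ℝ}
    (hχ : SingleSpinClass q χ) (D : ℕ → Finset (Site d)) (ξ : Config d) (N : ℕ)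
    (J : Edge d → ℝ) : StateLaw d :=
  (⟨(N + 1 : ℝ≥0∞)⁻¹ • ∑ n ∈ Finset.range (N + 1), Measure.dirac (localGibbs hq hχ (D n) J ξ),
    isProbabilityMeasure_average _ N⟩ : ProbabilityMeasure (State d))

end LatticeSpin

end

open LatticeSpin

/-! Fix finitely supported data only through test functions: the space of states embeds into the
compact metrizable space of laws on `[-∞, ∞]^{ℤ^d}`, so countably many bounded continuous functions
`F k`, independent of `J`, determine a law on states. Composed with the local Gibbs states of boxes,
they give countably many bounded sequences of random variables in `J`.

A Komlós-type argument in `L²(ν)` (`exists_strictMono_ae_tendsto_average`) selects one subsequence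
of boxes along which all Cesàro averages converge for almost every `J`. Along an ultrafilter each
bounded sequence has a weak limit; a greedy choice makes the centred variables almost orthogonal, so
their partial sums have variance `O(N)`, and convergence along the squares plus monotone
interpolation gives the strong law.

Convergence of these integrals becomes weak convergence through compactness. Young's inequality with
`1/q + 2/p = 1` bounds the energy at one site by `p`-th powers of the neighbouring spins with a
small prefactor. Consistency of the kernels carries this to larger volumes, and summation against
`w` absorbs the neighbour terms, so the weighted `p`-th moment is bounded uniformly in the volume
(`exists_lintegral_powerSum_gibbsKernel_le`). For fixed `J` all local states thus lie in one compact
set, which carries every empirical metastate.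

A limit law charges only cluster points of the local states, since finitely many terms do not matter
in an average. Such points are tempered by the moment bound, and satisfy the DLR equation because
the kernels are consistent and map bounded continuous functions to bounded continuous functions.
Both properties pass to mixtures, which settles the barycentre. -/

noncomputable section

/-! ### Almost sure Cesàro convergence along a subsequence -/

section CesaroSubsequence

open scoped InnerProductSpace

/-- Bounded sequences in a Hilbert space converge weakly along ultrafilters. -/
theorem exists_tendsto_inner_ultrafilter {H : Type*} [NormedAddCommGroup H]
    [InnerProductSpace ℝ H] [CompleteSpace H] {B : ℝ} (f : ℕ → H) (hf : ∀ n, ‖f n‖ ≤ B)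
    (U : Ultrafilter ℕ) :
    ∃ g : H, ∀ h : H, Tendsto (fun n => ⟪f n, h⟫_ℝ) U (𝓝 ⟪g, h⟫_ℝ) := by
  let F : ℕ → WeakDual ℝ H := fun n =>
    StrongDual.toWeakDual (InnerProductSpace.toDual ℝ H (f n))
  -- Banach–Alaoglu: the image ultrafilter lives on a weak-* compact ball and therefore converges.
  obtain ⟨φ, -, hφ⟩ := (WeakDual.isCompact_closedBall (𝕜 := ℝ) (E := H) 0 B).ultrafilter_le_nhds
    (U.map F) (by
      rw [Ultrafilter.coe_map, le_principal_iff]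
      refine mem_map.2 (Eventually.of_forall fun n => ?_)
      simpa [F] using hf n)
  rw [Ultrafilter.coe_map] at hφ
  refine ⟨(InnerProductSpace.toDual ℝ H).symm (WeakDual.toStrongDual φ), fun h => ?_⟩
  have h1 := ((WeakBilin.eval_continuous (topDualPairing ℝ H) h).tendsto φ).comp hφ
  simpa [topDualPairing_apply, F, Function.comp_def] using! h1

/-- A subsequence along which the centred partial sums grow in square norm at most linearly,
simultaneously for countably many bounded sequences. -/
theorem exists_strictMono_norm_sum_sq_le {H : Type*} [NormedAddCommGroup H]
    [InnerProductSpace ℝ H] [CompleteSpace H] (f : ℕ → ℕ → H) (B : ℕ → ℝ)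
    (hf : ∀ k n, ‖f k n‖ ≤ B k) :
    ∃ (φ : ℕ → ℕ) (g : ℕ → H), StrictMono φ ∧ ∀ k, ∃ C : ℝ, ∀ N : ℕ,
      ‖∑ i ∈ Finset.range N, (f k (φ i) - g k)‖ ^ 2 ≤ C * N := by
  let U : Ultrafilter ℕ := hyperfilter ℕ
  choose g hg using fun k => exists_tendsto_inner_ultrafilter (f k) (hf k) U
  let u : ℕ → ℕ → H := fun k n => f k n - g k
  have hu (k : ℕ) (h : H) : Tendsto (fun n => ⟪h, u k n⟫_ℝ) U (𝓝 0) := by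
    have := (hg k h).sub_const ⟪g k, h⟫_ℝ
    simp only [sub_self, ← inner_sub_left] at this
    simpa only [u, real_inner_comm] using this
  -- Greedy choice. Restricting to `k ≤ x` leaves finitely many conditions at each stage, each valid
  -- on a set of the ultrafilter; every fixed `k` is neglected only at finitely many `x`.
  obtain ⟨φ, -, hφ⟩ := exists_seq_of_forall_finset_exists (fun _ : ℕ => True)
    (fun x y => x < y ∧ ∀ k ≤ x, |⟪u k x, u k y⟫_ℝ| ≤ (1 / 2) ^ x) (by
      intro s _
      have h1 : ∀ᶠ y in (U : Filter ℕ), ∀ x ∈ s, x < y ∧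
          ∀ k ≤ x, |⟪u k x, u k y⟫_ℝ| ≤ (1 / 2) ^ x := by
        rw [Filter.eventually_all_finset]
        intro x _
        refine Filter.Eventually.and ?_ ?_
        · exact (Nat.hyperfilter_le_atTop) (eventually_gt_atTop x)
        · have h2 (k : ℕ) : ∀ᶠ y in (U : Filter ℕ), |⟪u k x, u k y⟫_ℝ| ≤ (1 / 2) ^ x := by
            have := (hu k (u k x)).abs
            rw [abs_zero] at this
            exact this.eventually_le_const (by positivity)
          exact (Filter.eventually_all_finite (Set.finite_Iic x)).2 fun k _ => h2 k
      obtain ⟨y, hy⟩ := h1.exists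
      exact ⟨y, trivial, hy⟩)
  have hmono : StrictMono φ := fun m n h => (hφ m n h).1
  refine ⟨φ, g, hmono, fun k => ?_⟩
  let D : ℝ := B k + ‖g k‖
  have hD (n : ℕ) : ‖u k n‖ ≤ D := (norm_sub_le _ _).trans (add_le_add_left (hf k n) _)
  have hD0 : 0 ≤ D := (norm_nonneg _).trans (hD 0)
  -- The `2` is the geometric series of the almost orthogonal terms; `k * D ^ 2` pays by
  -- Cauchy–Schwarz for the indices `i < k`, where the greedy choice may say nothing about `k`.
  have hin (j : ℕ) : ⟪∑ i ∈ Finset.range j, u k (φ i), u k (φ j)⟫_ℝ ≤ 2 + k * D ^ 2 := by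
    have hterm (i : ℕ) (hi : i ∈ Finset.range j) : ⟪u k (φ i), u k (φ j)⟫_ℝ ≤
        (1 / 2) ^ i + if i < k then D ^ 2 else 0 := by
      rw [Finset.mem_range] at hi
      split_ifs with h
      · have := (real_inner_le_norm (u k (φ i)) (u k (φ j))).trans
          (mul_le_mul (hD _) (hD _) (norm_nonneg _) hD0)
        have h0 : (0 : ℝ) ≤ (1 / 2) ^ i := by positivity
        nlinarith
      · have hk : k ≤ φ i := (not_lt.1 h).trans (hmono.le_apply)
        have h1 := (le_abs_self _).trans ((hφ i j hi).2 k hk)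
        have h2 : ((1 : ℝ) / 2) ^ φ i ≤ (1 / 2) ^ i :=
          pow_le_pow_of_le_one (by norm_num) (by norm_num) hmono.le_apply
        linarith
    rw [sum_inner]
    refine (Finset.sum_le_sum hterm).trans ?_
    rw [Finset.sum_add_distrib]
    refine add_le_add ?_ ?_
    · have h1 : Summable fun i : ℕ => ((1 : ℝ) / 2) ^ i := summable_geometric_two
      exact (h1.sum_le_tsum _ fun _ _ => by positivity).trans tsum_geometric_two.le
    · rw [← Finset.sum_filter, Finset.sum_const, nsmul_eq_mul]
      have : (Finset.filter (fun i => i < k) (Finset.range j)).card ≤ k := by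
        conv_rhs => rw [← Finset.card_range k]
        exact Finset.card_le_card fun i hi => by simp at hi ⊢; exact hi.2
      gcongr
  -- This constant bounds the increment of the squared norm: twice the cross term plus `‖u k (φ N)‖
  -- ^ 2`.
  refine ⟨2 * (2 + k * D ^ 2) + D ^ 2, fun N => ?_⟩
  induction N with
  | zero => simp
  | succ N ih =>
    rw [Finset.sum_range_succ, norm_add_sq_real]
    have h1 := hin N
    have h2 : ‖u k (φ N)‖ ^ 2 ≤ D ^ 2 := pow_le_pow_left₀ (norm_nonneg _) (hD _) 2
    push_cast
    simp only [u] at *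
    linarith

/-- If the partial sums of a nonnegative sequence satisfy `∫ (∑ i < N, (Y i - g))² ≤ C N`, then
the averages converge almost surely. -/
theorem ae_tendsto_average_of_integral_sq_le {Ω : Type*} [MeasurableSpace Ω] {ν : Measure Ω}
    {Y : ℕ → Ω → ℝ} (hY0 : ∀ n ω, 0 ≤ Y n ω) {g : Ω → ℝ} {C : ℝ}
    (hint : ∀ N : ℕ, AEMeasurable (fun ω => ∑ i ∈ Finset.range N, (Y i ω - g ω)) ν)
    (hC : ∀ N : ℕ, ∫⁻ ω, ENNReal.ofReal ((∑ i ∈ Finset.range N, (Y i ω - g ω)) ^ 2) ∂ν ≤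
      ENNReal.ofReal (C * N)) :
    ∀ᵐ ω ∂ν, Tendsto (fun N : ℕ => (∑ i ∈ Finset.range N, Y i ω) / N) atTop (𝓝 (g ω)) := by
  -- Along the squares the second moments of the normalized sums are at most `|C| / (n + 1) ^ 2`,
  -- which is summable.
  let c : ℕ → ℕ := fun n => (n + 1) ^ 2
  let Z : ℕ → Ω → ℝ := fun n ω => (∑ i ∈ Finset.range (c n), (Y i ω - g ω)) / c n
  have hc (n : ℕ) : (0 : ℝ) < c n := by simp only [c]; positivity
  have hZ (n : ℕ) : ∫⁻ ω, ENNReal.ofReal (Z n ω ^ 2) ∂ν ≤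
      ENNReal.ofReal (|C| * (1 / ((n : ℝ) + 1) ^ 2)) := by
    have h1 (ω : Ω) : ENNReal.ofReal (Z n ω ^ 2) = ENNReal.ofReal (1 / (c n : ℝ) ^ 2) *
        ENNReal.ofReal ((∑ i ∈ Finset.range (c n), (Y i ω - g ω)) ^ 2) := by
      rw [← ENNReal.ofReal_mul (by positivity)]
      congr 1
      simp only [Z]
      ring
    simp_rw [h1]
    rw [lintegral_const_mul' _ _ ENNReal.ofReal_ne_top]
    refine (mul_le_mul_right (hC (c n)) _).trans ?_
    rw [← ENNReal.ofReal_mul (by positivity)]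
    refine ENNReal.ofReal_le_ofReal ?_
    have h2 : 1 / (c n : ℝ) ^ 2 * (C * c n) = C * (1 / c n) := by
      have := (hc n).ne'
      field_simp
    have h3 : (c n : ℝ) = ((n : ℝ) + 1) ^ 2 := by simp only [c]; push_cast; ring
    rw [h2, h3]
    exact mul_le_mul_of_nonneg_right (le_abs_self C) (by positivity)
  have hsum : Summable fun n : ℕ => |C| * (1 / ((n : ℝ) + 1) ^ 2) := by
    refine Summable.mul_left _ ?_
    have := (summable_nat_add_iff 1).2 (Real.summable_one_div_nat_pow.2 (one_lt_two))
    simpa using this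
  have hfin : ∫⁻ ω, ∑' n, ENNReal.ofReal (Z n ω ^ 2) ∂ν ≠ ∞ := by
    rw [lintegral_tsum fun n => (((hint (c n)).div_const _).pow_const 2).ennreal_ofReal]
    refine ne_top_of_le_ne_top ?_ (ENNReal.tsum_le_tsum hZ)
    exact hsum.tsum_ofReal_ne_top
  have hae := ae_lt_top' (AEMeasurable.tsum fun n =>
    (((hint (c n)).div_const _).pow_const 2).ennreal_ofReal) hfin
  filter_upwards [hae] with ω hω
  have hlim : Tendsto (fun n => Z n ω) atTop (𝓝 0) := by
    have h1 := ENNReal.tendsto_atTop_zero_of_tsum_ne_top hω.ne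
    have h2 := (ENNReal.tendsto_toReal ENNReal.zero_ne_top).comp h1
    have h3 : Tendsto (fun n => Z n ω ^ 2) atTop (𝓝 0) := by
      refine h2.congr fun n => ?_
      exact ENNReal.toReal_ofReal (sq_nonneg (Z n ω))
    have h4 := (Real.continuous_sqrt.tendsto 0).comp h3
    rw [Real.sqrt_zero] at h4
    refine (tendsto_zero_iff_abs_tendsto_zero _).2 (h4.congr fun n => ?_)
    simp [Real.sqrt_sq_eq_abs]
  -- Nonnegativity makes the uncentred partial sums monotone; since consecutive squares have ratio
  -- tending to `1`, convergence along them fills the gaps.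
  refine tendsto_div_of_monotone_of_exists_subseq_tendsto_div _ _ ?_ fun a ha => ?_
  · refine monotone_nat_of_le_succ fun n => ?_
    rw [Finset.sum_range_succ]
    linarith [hY0 n ω]
  · refine ⟨c, ?_, ?_, ?_⟩
    · have h1 : Tendsto (fun n : ℕ => (1 + 1 / ((n : ℝ) + 1)) ^ 2) atTop (𝓝 1) := by
        have := ((tendsto_one_div_add_atTop_nhds_zero_nat (𝕜 := ℝ)).const_add 1).pow 2
        simpa using this
      filter_upwards [h1.eventually_le_const ha] with n hn
      have h2 : (c (n + 1) : ℝ) = (1 + 1 / ((n : ℝ) + 1)) ^ 2 * c n := by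
        simp only [c]
        push_cast
        field_simp
      rw [h2]
      exact mul_le_mul_of_nonneg_right hn (hc n).le
    · refine tendsto_atTop_mono (fun n => ?_) tendsto_id
      simp only [c, id]
      nlinarith
    · have := hlim.add_const (g ω)
      rw [zero_add] at this
      refine this.congr fun n => ?_
      simp only [Z, Finset.sum_sub_distrib, Finset.sum_const, Finset.card_range, nsmul_eq_mul]
      have := (hc n).ne'
      field_simp
      ring

/-- The coercion of `Lp` to functions commutes with finite sums. -/
theorem Lp_coeFn_sum_range {Ω : Type*} [MeasurableSpace Ω] {ν : Measure Ω}
    (f : ℕ → Lp ℝ 2 ν) (N : ℕ) :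
    ∀ᵐ ω ∂ν, (∑ i ∈ Finset.range N, f i : Lp ℝ 2 ν) ω = ∑ i ∈ Finset.range N, f i ω := by
  induction N with
  | zero =>
    filter_upwards [Lp.coeFn_zero ℝ 2 ν] with ω hω
    simpa using hω
  | succ N ih =>
    filter_upwards [ih, Lp.coeFn_add (∑ i ∈ Finset.range N, f i) (f N)] with ω h1 h2
    rw [Finset.sum_range_succ, Finset.sum_range_succ, h2, Pi.add_apply, h1]

/-- A Komlós-type statement: countably many bounded sequences of random variables have a common
subsequence whose averages converge almost surely. -/
theorem exists_strictMono_ae_tendsto_average {Ω : Type*} [MeasurableSpace Ω] (ν : Measure Ω)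
    [IsProbabilityMeasure ν] (X : ℕ → ℕ → Ω → ℝ) (hX : ∀ k n, Measurable (X k n)) (B : ℕ → ℝ)
    (hB : ∀ k n ω, |X k n ω| ≤ B k) :
    ∃ φ : ℕ → ℕ, StrictMono φ ∧ ∀ᵐ ω ∂ν, ∀ k, ∃ l : ℝ,
      Tendsto (fun N : ℕ => (∑ i ∈ Finset.range N, X k (φ i) ω) / N) atTop (𝓝 l) := by
  have hm (k n : ℕ) : MemLp (X k n) 2 ν :=
    MemLp.of_bound (hX k n).aestronglyMeasurable (B k) (Eventually.of_forall (hB k n))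
  obtain ⟨φ, g, hφ, hg⟩ := exists_strictMono_norm_sum_sq_le (fun k n => (hm k n).toLp)
    B (by
      intro k n
      refine (Lp.norm_le_of_ae_bound (C := B k) ((abs_nonneg _).trans (hB k 0 (Classical.choice
        ν.nonempty_of_neZero))) ?_).trans ?_
      · filter_upwards [(hm k n).coeFn_toLp] with ω hω
        rw [hω]
        exact hB k n ω
      · simp [measureUnivNNReal])
  refine ⟨φ, hφ, ?_⟩
  rw [ae_all_iff]
  intro k
  obtain ⟨C, hC⟩ := hg k
  -- Adding `B k` to both the variables and the limit makes the variables nonnegative and leaves the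
  -- centred sums unchanged.
  have key := ae_tendsto_average_of_integral_sq_le (ν := ν) (Y := fun i ω => X k (φ i) ω + B k)
    (g := fun ω => g k ω + B k) (C := C)
    (fun n ω => by linarith [neg_abs_le (X k (φ n) ω), hB k (φ n) ω]) ?_ ?_
  · filter_upwards [key] with ω hω
    refine ⟨g k ω, ?_⟩
    have h1 := hω.sub_const (B k)
    rw [add_sub_cancel_right] at h1
    refine h1.congr' ?_
    filter_upwards [eventually_gt_atTop 0] with N hN
    have : (N : ℝ) ≠ 0 := by positivity
    rw [Finset.sum_add_distrib, Finset.sum_const, Finset.card_range, nsmul_eq_mul]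
    field_simp
    ring
  · intro N
    refine Finset.aemeasurable_fun_sum _ fun i _ => ?_
    exact ((hX k _).add_const _).aemeasurable.sub
      ((Lp.aestronglyMeasurable (g k)).aemeasurable.add_const _)
  · intro N
    set T : Lp ℝ 2 ν := ∑ i ∈ Finset.range N, ((hm k (φ i)).toLp - g k) with hT
    have h1 : ∀ᵐ ω ∂ν, T ω = ∑ i ∈ Finset.range N, (X k (φ i) ω - g k ω) := by
      have h2 : ∀ᵐ ω ∂ν, ∀ i, ((hm k (φ i)).toLp - g k : Lp ℝ 2 ν) ω = X k (φ i) ω - g k ω := by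
        rw [ae_all_iff]
        intro i
        filter_upwards [(hm k (φ i)).coeFn_toLp, Lp.coeFn_sub (hm k (φ i)).toLp (g k)]
          with ω h3 h4
        rw [h4, Pi.sub_apply, h3]
      have h5 := Lp_coeFn_sum_range (fun i => (hm k (φ i)).toLp - g k) N
      filter_upwards [h2, h5] with ω h6 h7
      rw [hT, h7]
      exact Finset.sum_congr rfl fun i _ => h6 i
    have h2 : ∫⁻ ω, ENNReal.ofReal ((∑ i ∈ Finset.range N,
        (X k (φ i) ω + B k - (g k ω + B k))) ^ 2) ∂ν = ∫⁻ ω, ENNReal.ofReal (T ω ^ 2) ∂ν := by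
      refine lintegral_congr_ae ?_
      filter_upwards [h1] with ω hω
      rw [hω]
      simp only [add_sub_add_right_eq_sub]
    rw [h2, ← ofReal_integral_eq_lintegral_ofReal (Lp.memLp T).integrable_sq
      (Eventually.of_forall fun _ => sq_nonneg _)]
    refine ENNReal.ofReal_le_ofReal ((le_of_eq ?_).trans (hC N))
    rw [← hT, ← real_inner_self_eq_norm_sq, L2.inner_def]
    simp [sq]

end CesaroSubsequence
end

noncomputable section

/-! ### Weak convergence of probability measures -/

section WeakConvergence

/-- The push-forward along an embedding is an embedding of the spaces of probability measures. -/
theorem isEmbedding_probabilityMeasure_map {X Y : Type*}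
    [TopologicalSpace X] [TopologicalSpace.MetrizableSpace X] [SecondCountableTopology X]
    [MeasurableSpace X] [BorelSpace X]
    [TopologicalSpace Y] [TopologicalSpace.MetrizableSpace Y] [SecondCountableTopology Y]
    [MeasurableSpace Y] [BorelSpace Y] {i : X → Y} (hi : IsEmbedding i) :
    IsEmbedding fun μ : ProbabilityMeasure X => μ.map hi.continuous.measurable.aemeasurable := by
  refine IsInducing.isEmbedding (isInducing_iff_nhds.2 fun μ => le_antisymm ?_ ?_)
  · exact ((ProbabilityMeasure.continuous_map hi.continuous).tendsto μ).le_comap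
  · change Tendsto (fun μ' : ProbabilityMeasure X => μ') (comap (fun μ : ProbabilityMeasure X =>
      μ.map hi.continuous.measurable.aemeasurable) _) _
    -- Portmanteau: an open set of `X` is the preimage of an open set `V` of `Y`, and the bound for
    -- `V` is the bound needed.
    refine tendsto_of_forall_isOpen_le_liminf' fun G hG => ?_
    obtain ⟨V, hV, rfl⟩ := hi.isOpen_iff.1 hG
    have h := ProbabilityMeasure.le_liminf_measure_open_of_tendsto (tendsto_comap (f := fun μ :
      ProbabilityMeasure X => μ.map hi.continuous.measurable.aemeasurable)
      (x := 𝓝 (μ.map hi.continuous.measurable.aemeasurable))) hV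
    simpa only [ProbabilityMeasure.map_apply' _ _ hV.measurableSet, id] using h

/-- On a space which embeds into a compact metrizable space, countably many bounded continuous
functions separate the probability measures. -/
theorem exists_seq_boundedContinuous_separating {S Q : Type*} [TopologicalSpace S]
    [MeasurableSpace S] [BorelSpace S] [TopologicalSpace Q] [CompactSpace Q]
    [TopologicalSpace.MetrizableSpace Q] {Φ : S → Q} (hΦ : IsEmbedding Φ) :
    ∃ F : ℕ → S →ᵇ ℝ, ∀ m m' : ProbabilityMeasure S,
      (∀ k, ∫ x, F k x ∂(m : Measure S) = ∫ x, F k x ∂(m' : Measure S)) → m = m' := by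
  let _ : MeasurableSpace Q := borel Q
  have _ : BorelSpace Q := ⟨rfl⟩
  have hmeas : Measurable Φ := hΦ.continuous.measurable
  let F : C(Q, ℝ) → S →ᵇ ℝ := fun h =>
    (BoundedContinuousFunction.mkOfCompact h).compContinuous ⟨Φ, hΦ.continuous⟩
  have hF (h : C(Q, ℝ)) (x : S) : F h x = h (Φ x) := rfl
  have hcont (m : ProbabilityMeasure S) :
      Continuous fun h : C(Q, ℝ) => ∫ x, F h x ∂(m : Measure S) := by
    refine LipschitzWith.continuous (K := 1) (LipschitzWith.of_dist_le_mul fun h h' => ?_)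
    rw [dist_eq_norm, ← integral_sub ((F h).integrable _) ((F h').integrable _)]
    refine (norm_integral_le_of_norm_le_const (C := dist h h')
      (Eventually.of_forall fun x => ?_)).trans ?_
    · rw [← dist_eq_norm, hF, hF]
      exact ContinuousMap.dist_apply_le_dist (Φ x)
    · simp
  -- `C(Q, ℝ)` is separable, and integration is 1-Lipschitz in the test function, so a dense
  -- sequence determines all integrals.
  refine ⟨fun k => F (TopologicalSpace.denseSeq C(Q, ℝ) k), fun m m' hmm => ?_⟩
  have hall : (fun h : C(Q, ℝ) => ∫ x, F h x ∂(m : Measure S)) =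
      fun h : C(Q, ℝ) => ∫ x, F h x ∂(m' : Measure S) :=
    (hcont m).ext_on (TopologicalSpace.denseRange_denseSeq C(Q, ℝ)) (hcont m') (by
      rintro _ ⟨k, rfl⟩
      exact hmm k)
  have _ := Measure.isProbabilityMeasure_map (μ := (m : Measure S)) hmeas.aemeasurable
  have _ := Measure.isProbabilityMeasure_map (μ := (m' : Measure S)) hmeas.aemeasurable
  have hmap : (m : Measure S).map Φ = (m' : Measure S).map Φ := by
    refine ext_of_forall_integral_eq_of_IsFiniteMeasure fun f => ?_
    rw [integral_map hmeas.aemeasurable f.continuous.aestronglyMeasurable,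
      integral_map hmeas.aemeasurable f.continuous.aestronglyMeasurable]
    exact congr_fun hall f.toContinuousMap
  refine Subtype.ext (Measure.ext fun A hA => ?_)
  have hA' : MeasurableSet[(borel Q).comap Φ] A := by
    rw [← borel_comap, ← hΦ.eq_induced, ← BorelSpace.measurable_eq (α := S)]
    exact hA
  obtain ⟨B, hB, rfl⟩ := hA'
  have := congr_arg (fun μ => μ B) hmap
  simp only [Measure.map_apply hmeas hB] at this
  exact this

/-- Probability measures on a fixed compact set converge weakly as soon as the integrals of
separating functions converge. -/
theorem exists_tendsto_of_tendsto_integral {S : Type*} [TopologicalSpace S] [T2Space S]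
    [MeasurableSpace S] [BorelSpace S] {F : ℕ → S →ᵇ ℝ}
    (hF : ∀ m m' : ProbabilityMeasure S,
      (∀ k, ∫ x, F k x ∂(m : Measure S) = ∫ x, F k x ∂(m' : Measure S)) → m = m')
    {K : Set S} (hK : IsCompact K) (μ : ℕ → ProbabilityMeasure S)
    (hμ : ∀ N, (μ N : Measure S) Kᶜ = 0)
    (hlim : ∀ k, ∃ l : ℝ, Tendsto (fun N => ∫ x, F k x ∂(μ N : Measure S)) atTop (𝓝 l)) :
    ∃ m : ProbabilityMeasure S, Tendsto μ atTop (𝓝 m) := by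
  have hC := isCompact_setOfPred_probabilityMeasure_mass_eq_compl_isCompact_le
    (u := fun _ => 0) (K := fun _ => K) tendsto_const_nhds (fun _ => hK) (.inr monotone_const)
  have hmem : ∀ N, μ N ∈ {μ : ProbabilityMeasure S | ∀ _ : ℕ, μ Kᶜ ≤ 0} := fun N _ => by
    simp [ProbabilityMeasure.null_iff_toMeasure_null, hμ N]
  choose l hl using hlim
  have hval (m : ProbabilityMeasure S) (hm : MapClusterPt m atTop μ) (k : ℕ) :
      ∫ x, F k x ∂(m : Measure S) = l k := by
    obtain ⟨U, hU, hUm⟩ := mapClusterPt_iff_ultrafilter.1 hm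
    exact tendsto_nhds_unique
      (ProbabilityMeasure.tendsto_iff_forall_integral_tendsto.1 hUm (F k)) ((hl k).mono_left hU)
  obtain ⟨m, -, hm⟩ := hC.exists_mapClusterPt_of_frequently
    (Frequently.of_forall (f := atTop) hmem)
  -- In a compact set a sequence converges once its cluster point is unique, and the limits `l k`
  -- identify it.
  refine ⟨m, hC.tendsto_nhds_of_unique_mapClusterPt (Eventually.of_forall hmem) fun m' _ hm' => ?_⟩
  exact hF _ _ fun k => (hval m' hm' k).trans (hval m hm k).symm

/-- For the Borel `σ`-field of the weak topology, `μ ↦ μ A` is measurable. -/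
theorem measurable_probabilityMeasure_toMeasure {P X : Type*} [TopologicalSpace P]
    [MeasurableSpace P] [BorelSpace P] [TopologicalSpace X] [TopologicalSpace.MetrizableSpace X]
    [SecondCountableTopology X] [MeasurableSpace X] [BorelSpace X]
    {f : P → ProbabilityMeasure X} (hf : Continuous f) :
    Measurable fun m => (f m : Measure X) := by
  refine Measurable.measure_of_isPiSystem_of_isProbabilityMeasure
    (BorelSpace.measurable_eq (α := X)) isPiSystem_isOpen fun G hG => ?_
  -- By portmanteau, the mass of an open set is lower semicontinuous; open sets form a generating
  -- π-system.
  refine LowerSemicontinuous.measurable fun m y hy => ?_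
  have h := ProbabilityMeasure.le_liminf_measure_open_of_tendsto (hf.tendsto m) hG
  exact eventually_lt_of_lt_liminf (hy.trans_le h)

end WeakConvergence

/-! ### Topology of the space of states -/

namespace LatticeSpin

/-- The embedding of `ℝ^{ℤ^d}` into the compact space `[-∞, ∞]^{ℤ^d}`. -/
theorem isEmbedding_coe_ereal (d : ℕ) :
    IsEmbedding fun (σ : Config d) (x : Site d) => ((σ x : ℝ) : EReal) :=
  IsEmbedding.piMap fun _ => EReal.isEmbedding_coe

/-- The embedding of `𝒫(ℝ^{ℤ^d})` into the compact space `𝒫([-∞, ∞]^{ℤ^d})`. -/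
def stateEmbedding (d : ℕ) (μ : State d) : ProbabilityMeasure (Site d → EReal) :=
  ProbabilityMeasure.map (Ω := Config d) μ
    (isEmbedding_coe_ereal d).continuous.measurable.aemeasurable

/-- Source of metrizability and second countability of `State d`, and of the countable separating
family of test functions. -/
theorem isEmbedding_stateEmbedding (d : ℕ) : IsEmbedding (stateEmbedding d) :=
  isEmbedding_probabilityMeasure_map (isEmbedding_coe_ereal d)

instance (d : ℕ) : TopologicalSpace.MetrizableSpace (State d) :=
  (isEmbedding_stateEmbedding d).metrizableSpace

instance (d : ℕ) : SecondCountableTopology (State d) :=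
  (isEmbedding_stateEmbedding d).secondCountableTopology

instance (d : ℕ) : TopologicalSpace.MetrizableSpace (StateLaw d) :=
  inferInstanceAs (TopologicalSpace.MetrizableSpace (ProbabilityMeasure (State d)))

instance {d : ℕ} (μ : State d) : IsProbabilityMeasure μ.toMeasure :=
  μ.2

instance {d : ℕ} (m : StateLaw d) : IsProbabilityMeasure m.toMeasure :=
  m.2

theorem measurable_state_toMeasure (d : ℕ) : Measurable (State.toMeasure (d := d)) :=
  measurable_probabilityMeasure_toMeasure (P := State d) (X := Config d) (f := fun μ => μ)
    continuous_id

theorem continuous_state_iff {d : ℕ} {T : Type*} [TopologicalSpace T] {f : T → State d} :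
    Continuous f ↔ ∀ g : Config d →ᵇ ℝ, Continuous fun t => ∫ σ, g σ ∂(f t).toMeasure :=
  ProbabilityMeasure.continuous_iff_forall_continuous_integral (Ω := Config d)

theorem continuous_stateLaw_iff {d : ℕ} {T : Type*} [TopologicalSpace T] {f : T → StateLaw d} :
    Continuous f ↔ ∀ g : State d →ᵇ ℝ, Continuous fun t => ∫ μ, g μ ∂(f t).toMeasure :=
  ProbabilityMeasure.continuous_iff_forall_continuous_integral (Ω := State d)

variable {d : ℕ}

/-! ### Energies as sums over edges -/

/-- The finite set of neighbours of a site. -/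
def nbrs (x : Site d) : Finset (Site d) := (lattice_neighborSet_finite x).toFinset

theorem mem_nbrs {x y : Site d} : y ∈ nbrs x ↔ (lattice d).Adj x y := by
  simp [nbrs]

/-- The edges with at least one endpoint in `Δ`. -/
def incident (Δ : Finset (Site d)) : Finset (Sym2 (Site d)) :=
  Δ.biUnion fun x => (nbrs x).image fun y => s(x, y)

theorem mem_incident {Δ : Finset (Site d)} {x y : Site d} :
    s(x, y) ∈ incident Δ ↔ (lattice d).Adj x y ∧ (x ∈ Δ ∨ y ∈ Δ) := by
  simp only [incident, Finset.mem_biUnion, Finset.mem_image, mem_nbrs, Sym2.eq_iff]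
  constructor
  · rintro ⟨a, ha, b, hab, ⟨rfl, rfl⟩ | ⟨rfl, rfl⟩⟩
    · exact ⟨hab, .inl ha⟩
    · exact ⟨hab.symm, .inr ha⟩
  · rintro ⟨h, hx | hy⟩
    · exact ⟨x, hx, y, h, .inl ⟨rfl, rfl⟩⟩
    · exact ⟨y, hy, x, h.symm, .inr ⟨rfl, rfl⟩⟩

/-- The contribution `J_{xy} η(x) η(y)` of the edge `⟨x, y⟩`. -/
def edgeTerm (J : Edge d → ℝ) (η : Config d) (e : Sym2 (Site d)) : ℝ :=
  coupling J e * (e.map η).mul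

theorem edgeTerm_mk (J : Edge d → ℝ) (η : Config d) (x y : Site d) :
    edgeTerm J η s(x, y) = coupling J s(x, y) * (η x * η y) := by
  simp [edgeTerm, Sym2.map_mk, Sym2.mul_mk]

/-- `-H_Δ` as a function of the whole configuration. -/
def energy (Δ : Finset (Site d)) (J : Edge d → ℝ) (η : Config d) : ℝ :=
  ∑ e ∈ incident Δ, edgeTerm J η e

theorem glue_of_mem {Δ : Finset (Site d)} {ξ : Config d} {σ : Δ → ℝ} {x : Site d} (h : x ∈ Δ) :
    glue Δ ξ σ x = σ ⟨x, h⟩ := by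
  simp [glue, h]

theorem glue_of_notMem {Δ : Finset (Site d)} {ξ : Config d} {σ : Δ → ℝ} {x : Site d}
    (h : x ∉ Δ) : glue Δ ξ σ x = ξ x := by
  simp [glue, h]

/-- An edge leaving `Δ` has exactly one endpoint in `Δ`, hence a unique orientation in the boundary
sum. The single sum treats inner and outer spins alike, which makes energies of nested volumes easy
to split. -/
theorem negEnergy_eq_energy (Δ : Finset (Site d)) (J : Edge d → ℝ) (ξ : Config d) (σ : Δ → ℝ) :
    negEnergy Δ J ξ σ = energy Δ J (glue Δ ξ σ) := by
  classical
  unfold negEnergy energy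
  rw [← Finset.sum_filter_add_sum_filter_not (incident Δ) (fun e => e ∈ Δ.sym2)]
  congr 1
  · refine Finset.sum_congr ?_ fun e _ => rfl
    ext e
    induction e using Sym2.ind with
    | _ x y =>
      simp only [Finset.mem_filter, Finset.mk_mem_sym2_iff, mem_incident, SimpleGraph.mem_edgeSet]
      tauto
  · rw [Finset.sum_sigma']
    refine Finset.sum_bij (fun a _ => s(a.1, a.2)) ?_ ?_ ?_ ?_
    · rintro ⟨x, y⟩ h
      simp only [Finset.mem_sigma, Finset.mem_sdiff, Set.Finite.mem_toFinset,
        SimpleGraph.mem_neighborSet] at h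
      simp only [Finset.mem_filter, mem_incident, Finset.mk_mem_sym2_iff]
      tauto
    · rintro ⟨x, y⟩ h ⟨x', y'⟩ h' hxy
      simp only [Finset.mem_sigma, Finset.mem_sdiff] at h h'
      rcases Sym2.eq_iff.1 hxy with ⟨h1, h2⟩ | ⟨h1, h2⟩
      · simp only at h1 h2
        subst h1 h2
        rfl
      · simp only at h1 h2
        subst h1 h2
        exact absurd h.1 h'.2.2
    · intro e he
      induction e using Sym2.ind with
      | _ x y =>
        simp only [Finset.mem_filter, mem_incident, Finset.mk_mem_sym2_iff] at he
        by_cases hx : x ∈ Δ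
        · refine ⟨⟨x, y⟩, ?_, rfl⟩
          simp only [Finset.mem_sigma, Finset.mem_sdiff, Set.Finite.mem_toFinset,
            SimpleGraph.mem_neighborSet]
          tauto
        · refine ⟨⟨y, x⟩, ?_, Sym2.eq_swap⟩
          simp only [Finset.mem_sigma, Finset.mem_sdiff, Set.Finite.mem_toFinset,
            SimpleGraph.mem_neighborSet, (lattice d).adj_comm y x]
          tauto
    · rintro ⟨x, y⟩ h
      simp only [Finset.mem_sigma, Finset.mem_sdiff] at h
      rw [edgeTerm_mk, glue_of_notMem h.2.2, mul_assoc]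

theorem measurable_edgeTerm (J : Edge d → ℝ) (e : Sym2 (Site d)) :
    Measurable fun η : Config d => edgeTerm J η e := by
  induction e using Sym2.ind with
  | _ x y =>
    simp only [edgeTerm_mk]
    exact ((measurable_pi_apply x).mul (measurable_pi_apply y)).const_mul _

theorem measurable_energy (Δ : Finset (Site d)) (J : Edge d → ℝ) : Measurable (energy Δ J) :=
  Finset.measurable_sum _ fun e _ => measurable_edgeTerm J e

/-- The unnormalized Gibbs density `exp(-H_Δ)`. -/
def boltzmann (Δ : Finset (Site d)) (J : Edge d → ℝ) (η : Config d) : ℝ≥0∞ :=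
  ENNReal.ofReal (Real.exp (energy Δ J η))

theorem measurable_boltzmann (Δ : Finset (Site d)) (J : Edge d → ℝ) :
    Measurable (boltzmann Δ J) :=
  (Real.measurable_exp.comp (measurable_energy Δ J)).ennreal_ofReal

/-- The integral of `exp(-H_Δ) f` over the spins in `Δ`. -/
def weighted (χ : Site d → ProbabilityMeasure ℝ) (Δ : Finset (Site d)) (J : Edge d → ℝ)
    (f : Config d → ℝ≥0∞) : Config d → ℝ≥0∞ :=
  lmarginal (fun x => (χ x : Measure ℝ)) Δ fun η => boltzmann Δ J η * f η

/-- The partition function. -/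
def partition (χ : Site d → ProbabilityMeasure ℝ) (Δ : Finset (Site d)) (J : Edge d → ℝ) :
    Config d → ℝ≥0∞ :=
  lmarginal (fun x => (χ x : Measure ℝ)) Δ (boltzmann Δ J)

theorem measurable_weighted (χ : Site d → ProbabilityMeasure ℝ) (Δ : Finset (Site d))
    (J : Edge d → ℝ) {f : Config d → ℝ≥0∞} (hf : Measurable f) :
    Measurable (weighted χ Δ J f) :=
  Measurable.lmarginal _ ((measurable_boltzmann Δ J).mul hf)

theorem measurable_partition (χ : Site d → ProbabilityMeasure ℝ) (Δ : Finset (Site d))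
    (J : Edge d → ℝ) : Measurable (partition χ Δ J) :=
  Measurable.lmarginal _ (measurable_boltzmann Δ J)

/-! ### Local Gibbs kernels and their consistency -/

section Kernel

variable {q : ℝ} {χ : Site d → ProbabilityMeasure ℝ}

theorem partition_eq_ofReal (hq : 1 < q) (hχ : SingleSpinClass q χ) (Δ : Finset (Site d))
    (J : Edge d → ℝ) (ξ : Config d) :
    partition χ Δ J ξ = ENNReal.ofReal (∫ σ, Real.exp (negEnergy Δ J ξ σ)
      ∂Measure.pi fun x : Δ => (χ x : Measure ℝ)) := by
  rw [ofReal_integral_eq_lintegral_ofReal (integrable_exp_negEnergy hq hχ Δ J ξ)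
    (Eventually.of_forall fun _ => (Real.exp_pos _).le)]
  simp only [negEnergy_eq_energy]
  -- `glue Δ ξ σ` and `Function.updateFinset ξ Δ σ` agree by unfolding.
  rfl

theorem partition_ne_zero (hq : 1 < q) (hχ : SingleSpinClass q χ) (Δ : Finset (Site d))
    (J : Edge d → ℝ) (ξ : Config d) : partition χ Δ J ξ ≠ 0 := by
  rw [partition_eq_ofReal hq hχ, Ne, ENNReal.ofReal_eq_zero, not_le]
  exact integral_exp_pos (integrable_exp_negEnergy hq hχ Δ J ξ)

theorem partition_ne_top (hq : 1 < q) (hχ : SingleSpinClass q χ) (Δ : Finset (Site d))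
    (J : Edge d → ℝ) (ξ : Config d) : partition χ Δ J ξ ≠ ∞ := by
  rw [partition_eq_ofReal hq hχ]
  exact ENNReal.ofReal_ne_top

/-- As a quotient of `lmarginal`s, the kernel inherits measurability in the boundary condition and
the iterated integration of `lmarginal_union`. -/
theorem lintegral_gibbsKernel (hq : 1 < q) (hχ : SingleSpinClass q χ) (Δ : Finset (Site d))
    (J : Edge d → ℝ) (ξ : Config d) {f : Config d → ℝ≥0∞} (hf : Measurable f) :
    ∫⁻ η, f η ∂gibbsKernel χ Δ J ξ = weighted χ Δ J f ξ / partition χ Δ J ξ := by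
  have hpos := integral_exp_pos (integrable_exp_negEnergy hq hχ Δ J ξ)
  rw [gibbsKernel, lintegral_map hf (measurable_glue Δ ξ), lintegral_tilted]
  rw [partition_eq_ofReal hq hχ, weighted, lmarginal, ENNReal.div_eq_inv_mul,
    ← lintegral_const_mul' _ _ (by simpa using hpos)]
  refine lintegral_congr fun σ => ?_
  rw [ENNReal.ofReal_div_of_pos hpos, ENNReal.div_eq_inv_mul, mul_assoc, negEnergy_eq_energy]
  rfl

theorem measurable_gibbsKernel (hq : 1 < q) (hχ : SingleSpinClass q χ) (Δ : Finset (Site d))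
    (J : Edge d → ℝ) : Measurable (gibbsKernel χ Δ J) := by
  refine Measure.measurable_of_measurable_coe _ fun A hA => ?_
  have h1 (η : Config d) : gibbsKernel χ Δ J η A =
      weighted χ Δ J (A.indicator 1) η / partition χ Δ J η := by
    rw [← lintegral_gibbsKernel hq hχ Δ J η (measurable_one.indicator hA),
      lintegral_indicator_one hA]
  simp only [h1]
  exact (measurable_weighted χ Δ J (measurable_one.indicator hA)).div (measurable_partition χ Δ J)

/-- Sites outside of `Δ` carry the boundary condition. -/
theorem lintegral_gibbsKernel_apply_of_notMem (hq : 1 < q) (hχ : SingleSpinClass q χ)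
    (Δ : Finset (Site d)) (J : Edge d → ℝ) (ξ : Config d) {f : ℝ → ℝ≥0∞} (hf : Measurable f)
    {x : Site d} (hx : x ∉ Δ) : ∫⁻ η, f (η x) ∂gibbsKernel χ Δ J ξ = f (ξ x) := by
  have := isProbabilityMeasure_tilted (integrable_exp_negEnergy hq hχ Δ J ξ)
  rw [gibbsKernel, lintegral_map (f := fun η : Config d => f (η x)) (hf.comp (measurable_pi_apply x))
    (measurable_glue Δ ξ)]
  simp [glue_of_notMem hx]

/-- Splitting the density of a larger volume. -/
theorem boltzmann_eq_mul_of_subset {Δ Λ : Finset (Site d)} (h : Δ ⊆ Λ) (J : Edge d → ℝ)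
    (η : Config d) : boltzmann Λ J η = ENNReal.ofReal (Real.exp
      (∑ e ∈ incident Λ \ incident Δ, edgeTerm J η e)) * boltzmann Δ J η := by
  rw [boltzmann, boltzmann, ← ENNReal.ofReal_mul (Real.exp_pos _).le, ← Real.exp_add, energy,
    energy, Finset.sum_sdiff]
  exact Finset.biUnion_subset_biUnion_of_subset_left _ h

theorem sum_edgeTerm_sdiff_congr {Δ Λ : Finset (Site d)} (J : Edge d → ℝ) {η η' : Config d}
    (h : ∀ x ∉ Δ, η x = η' x) :
    ∑ e ∈ incident Λ \ incident Δ, edgeTerm J η e =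
      ∑ e ∈ incident Λ \ incident Δ, edgeTerm J η' e := by
  refine Finset.sum_congr rfl fun e he => ?_
  rw [Finset.mem_sdiff] at he
  induction e using Sym2.ind with
  | _ x y =>
    rw [mem_incident, mem_incident] at he
    rw [edgeTerm_mk, edgeTerm_mk, h x (by tauto), h y (by tauto)]

/-- Integrating the density of the large volume over the small volume. -/
theorem lmarginal_boltzmann_mul {Δ Λ : Finset (Site d)} (h : Δ ⊆ Λ) (J : Edge d → ℝ)
    (f : Config d → ℝ≥0∞) (η : Config d) :
    lmarginal (fun x => (χ x : Measure ℝ)) Δ (fun η => boltzmann Λ J η * f η) η =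
      ENNReal.ofReal (Real.exp (∑ e ∈ incident Λ \ incident Δ, edgeTerm J η e)) *
        weighted χ Δ J f η := by
  rw [weighted, lmarginal, lmarginal, ← lintegral_const_mul' _ _ ENNReal.ofReal_ne_top]
  refine lintegral_congr fun σ => ?_
  rw [boltzmann_eq_mul_of_subset h, mul_assoc]
  congr 3
  refine sum_edgeTerm_sdiff_congr J fun x hx => ?_
  simp [Function.updateFinset, hx]

/-- The local Gibbs kernels are consistent: `π_Λ π_Δ = π_Λ` for `Δ ⊆ Λ`. -/
theorem lintegral_lintegral_gibbsKernel (hq : 1 < q) (hχ : SingleSpinClass q χ)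
    {Δ Λ : Finset (Site d)} (h : Δ ⊆ Λ) (J : Edge d → ℝ) (ξ : Config d)
    {f : Config d → ℝ≥0∞} (hf : Measurable f) :
    ∫⁻ η, ∫⁻ ζ, f ζ ∂gibbsKernel χ Δ J η ∂gibbsKernel χ Λ J ξ =
      ∫⁻ η, f η ∂gibbsKernel χ Λ J ξ := by
  let g : Config d → ℝ≥0∞ := fun η => weighted χ Δ J f η / partition χ Δ J η
  have hg : Measurable g := (measurable_weighted χ Δ J hf).div (measurable_partition χ Δ J)
  simp only [lintegral_gibbsKernel hq hχ Δ J _ hf]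
  rw [lintegral_gibbsKernel hq hχ Λ J ξ hg, lintegral_gibbsKernel hq hχ Λ J ξ hf]
  congr 1
  -- `g` does not see the spins in `Δ`, so it leaves the integral and its denominator cancels
  -- against the partition function.
  have hwg : weighted χ Δ J g = weighted χ Δ J f := by
    funext η
    have hc (σ : (i : Δ) → ℝ) : g (Function.updateFinset η Δ σ) = g η := by
      simp only [g, weighted, partition]
      congr 1 <;>
      · refine lmarginal_congr _ _ fun x hx => ?_
        simp [Function.updateFinset, hx]
    rw [weighted, lmarginal]
    simp only [hc]
    rw [lintegral_mul_const (f := fun σ => boltzmann Δ J (Function.updateFinset η Δ σ)) _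
      ((measurable_boltzmann Δ J).comp measurable_updateFinset)]
    change partition χ Δ J η * (weighted χ Δ J f η / partition χ Δ J η) = _
    exact ENNReal.mul_div_cancel (partition_ne_zero hq hχ Δ J η) (partition_ne_top hq hχ Δ J η)
  have hu : Λ = Λ \ Δ ∪ Δ := (Finset.sdiff_union_of_subset h).symm
  -- Integrate over `Δ` before `Λ \ Δ`; the edges not touching `Δ` factor out of the inner integral.
  have key {F : Config d → ℝ≥0∞} (hF : Measurable F) : weighted χ Λ J F =
      lmarginal (fun x => (χ x : Measure ℝ)) (Λ \ Δ) (fun η => ENNReal.ofReal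
        (Real.exp (∑ e ∈ incident Λ \ incident Δ, edgeTerm J η e)) * weighted χ Δ J F η) := by
    have h1 := lmarginal_union (fun x => (χ x : Measure ℝ)) (s := Λ \ Δ) (t := Δ)
      (fun η => boltzmann Λ J η * F η) ((measurable_boltzmann Λ J).mul hF)
      Finset.sdiff_disjoint
    rw [← hu] at h1
    rw [weighted, h1]
    congr 1
    funext η
    exact lmarginal_boltzmann_mul h J F η
  rw [key hg, key hf, hwg]

end Kernel

/-! ### Continuity in the couplings and the boundary condition -/

theorem continuous_coupling (e : Sym2 (Site d)) :
    Continuous fun J : Edge d → ℝ => coupling J e := by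
  unfold coupling
  split_ifs with h
  · exact continuous_apply _
  · exact continuous_const

theorem continuous_glue (Δ : Finset (Site d)) (σ : Δ → ℝ) :
    Continuous fun ξ : Config d => glue Δ ξ σ := by
  refine continuous_pi fun x => ?_
  unfold glue
  split_ifs with h
  · exact continuous_const
  · exact continuous_apply x

theorem continuous_edgeTerm (e : Sym2 (Site d)) :
    Continuous fun a : (Edge d → ℝ) × Config d => edgeTerm a.1 a.2 e := by
  induction e using Sym2.ind with
  | _ x y =>
    simp only [edgeTerm_mk]
    exact ((continuous_coupling _).comp continuous_fst).mul
      (((continuous_apply x).comp continuous_snd).mul ((continuous_apply y).comp continuous_snd))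

theorem continuous_negEnergy (Δ : Finset (Site d)) (σ : Δ → ℝ) :
    Continuous fun a : (Edge d → ℝ) × Config d => negEnergy Δ a.1 a.2 σ := by
  simp only [negEnergy_eq_energy, energy]
  exact continuous_finsetSum _ fun e _ => (continuous_edgeTerm e).comp
    (continuous_fst.prodMk ((continuous_glue Δ σ).comp continuous_snd))

/-- The volume `Δ` together with its neighbours. -/
def cover (Δ : Finset (Site d)) : Finset (Site d) := Δ ∪ Δ.biUnion nbrs

/-- A continuous function of the couplings and the boundary condition which controls the growth
of the energy. -/
def energyBound (Δ : Finset (Site d)) (a : (Edge d → ℝ) × Config d) : ℝ :=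
  (∑ e ∈ incident Δ, |coupling a.1 e|) * (1 + ∑ x ∈ cover Δ, a.2 x ^ 2)

theorem continuous_energyBound (Δ : Finset (Site d)) : Continuous (energyBound Δ) := by
  unfold energyBound
  refine Continuous.mul ?_ ?_
  · exact continuous_finsetSum _ fun e _ => ((continuous_coupling e).comp continuous_fst).abs
  · exact continuous_const.add (continuous_finsetSum _ fun x _ =>
      ((continuous_apply x).comp continuous_snd).pow 2)

theorem negEnergy_le_energyBound (Δ : Finset (Site d)) (a : (Edge d → ℝ) × Config d)
    (σ : Δ → ℝ) : negEnergy Δ a.1 a.2 σ ≤ energyBound Δ a * (1 + ∑ x, σ x ^ 2) := by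
  set S : ℝ := ∑ x, σ x ^ 2 with hS
  set R : ℝ := ∑ x ∈ cover Δ, a.2 x ^ 2 with hR
  have hS0 : 0 ≤ S := Finset.sum_nonneg fun _ _ => sq_nonneg _
  have hR0 : 0 ≤ R := Finset.sum_nonneg fun _ _ => sq_nonneg _
  have hle (x : Site d) (hx : x ∈ cover Δ) : glue Δ a.2 σ x ^ 2 ≤ S + R := by
    by_cases h : x ∈ Δ
    · rw [glue_of_mem h]
      have := Finset.single_le_sum (f := fun x => σ x ^ 2) (fun j _ => sq_nonneg _)
        (Finset.mem_univ (⟨x, h⟩ : Δ))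
      linarith
    · rw [glue_of_notMem h]
      have := Finset.single_le_sum (f := fun x => a.2 x ^ 2) (fun j _ => sq_nonneg _) hx
      linarith
  have hcov {x y : Site d} (h : s(x, y) ∈ incident Δ) : x ∈ cover Δ := by
    rw [mem_incident] at h
    simp only [cover, Finset.mem_union, Finset.mem_biUnion, mem_nbrs]
    rcases h with ⟨h, hx | hy⟩
    · exact .inl hx
    · exact .inr ⟨y, hy, h.symm⟩
  have h1 : negEnergy Δ a.1 a.2 σ ≤ (∑ e ∈ incident Δ, |coupling a.1 e|) * (S + R) := by
    rw [negEnergy_eq_energy, energy, Finset.sum_mul]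
    refine Finset.sum_le_sum fun e he => ?_
    induction e using Sym2.ind with
    | _ x y =>
      have hx := hle x (hcov he)
      have hy := hle y (hcov (Sym2.eq_swap (a := x) (b := y) ▸ he))
      rw [edgeTerm_mk]
      refine (le_abs_self _).trans ?_
      rw [abs_mul]
      refine mul_le_mul_of_nonneg_left ?_ (abs_nonneg _)
      rw [abs_le]
      constructor <;> nlinarith [sq_nonneg (glue Δ a.2 σ x - glue Δ a.2 σ y),
        sq_nonneg (glue Δ a.2 σ x + glue Δ a.2 σ y)]
  have h2 : 0 ≤ ∑ e ∈ incident Δ, |coupling a.1 e| := Finset.sum_nonneg fun _ _ => abs_nonneg _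
  refine h1.trans ?_
  rw [energyBound, mul_assoc]
  refine mul_le_mul_of_nonneg_left ?_ h2
  nlinarith

section Kernel

variable {q : ℝ} {χ : Site d → ProbabilityMeasure ℝ}

theorem integrable_exp_quadratic (hq : 1 < q) (hχ : SingleSpinClass q χ) (Δ : Finset (Site d))
    {C : ℝ} (hC : 0 < C) : Integrable (fun σ : Δ → ℝ => Real.exp (C * (1 + ∑ x, σ x ^ 2)))
      (Measure.pi fun x : Δ => (χ x : Measure ℝ)) := by
  have h := (Integrable.fintype_prod (f := fun (_ : Δ) (u : ℝ) => Real.exp (C * u ^ 2))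
    (μ := fun x : Δ => (χ x : Measure ℝ))
    (fun x => integrable_exp_sq hq hχ x hC)).const_mul (Real.exp C)
  refine h.congr (Eventually.of_forall fun σ => ?_)
  simp only
  rw [← Real.exp_sum, ← Real.exp_add, ← Finset.mul_sum]
  ring_nf

/-- Dominated convergence: near `a` the continuous `energyBound` stays below its value plus one, so
one Gaussian-type exponential, integrable by the assumption on `χ`, dominates throughout. -/
theorem continuous_integral_exp_mul (hq : 1 < q) (hχ : SingleSpinClass q χ)
    (Δ : Finset (Site d)) (f : Config d →ᵇ ℝ) :
    Continuous fun a : (Edge d → ℝ) × Config d =>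
      ∫ σ, Real.exp (negEnergy Δ a.1 a.2 σ) * f (glue Δ a.2 σ)
        ∂Measure.pi fun x : Δ => (χ x : Measure ℝ) := by
  rw [continuous_iff_continuousAt]
  intro a
  have hC : 0 < energyBound Δ a + 1 := by
    have : 0 ≤ energyBound Δ a := by unfold energyBound; positivity
    linarith
  refine continuousAt_of_dominated (bound := fun σ =>
    Real.exp ((energyBound Δ a + 1) * (1 + ∑ x, σ x ^ 2)) * ‖f‖) ?_ ?_ ?_ ?_
  · refine Eventually.of_forall fun b => Measurable.aestronglyMeasurable ?_
    exact (Real.measurable_exp.comp (measurable_negEnergy Δ b.1 b.2)).mul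
      (f.continuous.measurable.comp (measurable_glue Δ b.2))
  · have h1 := (continuous_energyBound Δ).continuousAt.eventually_lt
      (continuousAt_const (x := a) (y := energyBound Δ a + 1)) (by linarith)
    filter_upwards [h1] with b hb
    refine Eventually.of_forall fun σ => ?_
    rw [norm_mul, Real.norm_of_nonneg (Real.exp_pos _).le]
    refine mul_le_mul ?_ (f.norm_coe_le_norm _) (norm_nonneg _) (Real.exp_pos _).le
    refine Real.exp_le_exp.2 ((negEnergy_le_energyBound Δ b σ).trans ?_)
    exact mul_le_mul_of_nonneg_right hb.le (by positivity)
  · exact (integrable_exp_quadratic hq hχ Δ hC).mul_const _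
  · refine Eventually.of_forall fun σ => Continuous.continuousAt ?_
    exact (Real.continuous_exp.comp (continuous_negEnergy Δ σ)).mul
      (f.continuous.comp ((continuous_glue Δ σ).comp continuous_snd))

/-- Joint continuity of the local Gibbs kernel in the couplings and the boundary condition. -/
theorem continuous_integral_gibbsKernel (hq : 1 < q) (hχ : SingleSpinClass q χ)
    (Δ : Finset (Site d)) (f : Config d →ᵇ ℝ) :
    Continuous fun a : (Edge d → ℝ) × Config d => ∫ η, f η ∂gibbsKernel χ Δ a.1 a.2 := by
  have h1 (a : (Edge d → ℝ) × Config d) : ∫ η, f η ∂gibbsKernel χ Δ a.1 a.2 =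
      (∫ σ, Real.exp (negEnergy Δ a.1 a.2 σ) * f (glue Δ a.2 σ)
        ∂Measure.pi fun x : Δ => (χ x : Measure ℝ)) /
      ∫ σ, Real.exp (negEnergy Δ a.1 a.2 σ) ∂Measure.pi fun x : Δ => (χ x : Measure ℝ) := by
    rw [gibbsKernel, integral_map (measurable_glue Δ a.2).aemeasurable
      f.continuous.aestronglyMeasurable, integral_tilted, ← integral_div]
    refine integral_congr_ae (Eventually.of_forall fun σ => ?_)
    simp only [smul_eq_mul]
    ring
  simp only [h1]
  refine (continuous_integral_exp_mul hq hχ Δ f).div₀ ?_ fun a =>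
    (integral_exp_pos (integrable_exp_negEnergy hq hχ Δ a.1 a.2)).ne'
  simpa using continuous_integral_exp_mul hq hχ Δ (BoundedContinuousFunction.const (Config d) 1)

end Kernel

/-! Coordinates on the space of couplings. -/

theorem edgeWeight_pos {w : Site d → ℝ} (hw : IsWeight w) (e : Edge d) : 0 < edgeWeight w e := by
  obtain ⟨e, he⟩ := e
  induction e using Sym2.ind with
  | _ x y => exact add_pos (hw.pos x) (hw.pos y)

/-- Convexity of the `q`-th power gives the factor `2 ^ (q - 1)`. Without summability the `tsum` in
`normDist` would default to `0` and a small distance would carry no information. -/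
theorem summable_abs_sub_rpow {q : ℝ} (hq : 1 < q) {w : Site d → ℝ} (hw : IsWeight w)
    (J K : Couplings q w) : Summable fun e => |J e - K e| ^ q * edgeWeight w e := by
  refine Summable.of_nonneg_of_le (fun e => mul_nonneg (Real.rpow_nonneg (abs_nonneg _) _)
    (edgeWeight_pos hw e).le) (fun e => ?_) ((J.2.add K.2).mul_left (2 ^ (q - 1)))
  rw [← add_mul, ← mul_assoc]
  refine mul_le_mul_of_nonneg_right ?_ (edgeWeight_pos hw e).le
  have h1 : |J e - K e| ^ q ≤ (|J e| + |K e|) ^ q :=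
    Real.rpow_le_rpow (abs_nonneg _) (abs_sub _ _) (by linarith)
  refine h1.trans ?_
  exact_mod_cast NNReal.rpow_add_le_mul_rpow_add_rpow (Real.nnabs (J e)) (Real.nnabs (K e)) hq.le

/-- One summand is dominated by the `q`-th power of the norm distance. This is how the norm topology
enters: local states become continuous, hence measurable, functions of `J`. -/
theorem continuous_couplings_apply {q : ℝ} (hq : 1 < q) {w : Site d → ℝ} (hw : IsWeight w) :
    Continuous fun J : Couplings q w => (J : Edge d → ℝ) := by
  refine continuous_pi fun e => continuous_iff_continuousAt.2 fun J => ?_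
  rw [ContinuousAt, Metric.tendsto_nhds]
  intro ε hε
  have hwe := edgeWeight_pos hw e
  have hpos : 0 < (ε ^ q * edgeWeight w e) ^ (1 / q) := by positivity
  have hopen : IsOpen {K : Couplings q w |
      Couplings.normDist J K < (ε ^ q * edgeWeight w e) ^ (1 / q)} :=
    TopologicalSpace.isOpen_generateFrom_of_mem ⟨J, _, rfl⟩
  have hmem : J ∈ {K : Couplings q w |
      Couplings.normDist J K < (ε ^ q * edgeWeight w e) ^ (1 / q)} := by
    have h0 : Couplings.normDist J J = 0 := by
      have : q ≠ 0 := by linarith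
      simp [Couplings.normDist, Real.zero_rpow, this]
    rw [Set.mem_ofPred_eq, h0]
    exact hpos
  filter_upwards [hopen.mem_nhds hmem] with K hK
  have hq0 : 0 < q := by linarith
  have h1 : |J e - K e| ^ q * edgeWeight w e ≤ ∑' e, |J e - K e| ^ q * edgeWeight w e :=
    (summable_abs_sub_rpow hq hw J K).le_tsum e fun e _ =>
      mul_nonneg (Real.rpow_nonneg (abs_nonneg _) _) (edgeWeight_pos hw e).le
  have h2 : ∑' e, |J e - K e| ^ q * edgeWeight w e < ε ^ q * edgeWeight w e := by
    refine (Real.rpow_lt_rpow_iff (tsum_nonneg fun e => mul_nonneg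
      (Real.rpow_nonneg (abs_nonneg _) _) (edgeWeight_pos hw e).le) (by positivity)
      (z := 1 / q) (by positivity)).1 hK
  have h3 := lt_of_mul_lt_mul_right (h1.trans_lt h2) hwe.le
  rw [Real.rpow_lt_rpow_iff (abs_nonneg _) hε.le hq0] at h3
  rwa [Real.dist_eq, abs_sub_comm]

theorem continuous_localGibbs {q : ℝ} (hq : 1 < q) {χ : Site d → ProbabilityMeasure ℝ}
    (hχ : SingleSpinClass q χ) (Δ : Finset (Site d)) (ξ : Config d) :
    Continuous fun J : Edge d → ℝ => localGibbs hq hχ Δ J ξ := by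
  refine continuous_state_iff.2 fun g => ?_
  exact (continuous_integral_gibbsKernel hq hχ Δ g).comp (continuous_id.prodMk continuous_const)

/-! ### The moment estimate, uniform in the volume -/

/-- Young's inequality for three factors with exponents `q`, `p`, `p`, where
`1 / q + 2 / p = 1`. -/
theorem exists_abs_mul_mul_le {q : ℝ} (hq : 1 < q) {ε : ℝ} (hε : 0 < ε) :
    ∃ A : ℝ, 0 ≤ A ∧ ∀ J a b : ℝ, |J * (a * b)| ≤ A * |J| ^ q +
      (ε * |a| ^ (2 * q / (q - 1)) + ε * |b| ^ (2 * q / (q - 1))) := by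
  have hq1 : 0 < q - 1 := by linarith
  have hconj : q.HolderConjugate (q / (q - 1)) := Real.HolderConjugate.conjExponent hq
  set r : ℝ := q / (q - 1) with hr
  have hr1 : 1 < r := hconj.symm.lt
  have hr0 : 0 < r := by linarith
  have hp : 2 * q / (q - 1) = 2 * r := by rw [hr]; ring
  -- With `r` conjugate to `q` one has `p = 2 * r`. Young is applied to `(|J| / δ) * (δ * |a * b|)`,
  -- where `δ ^ r = ε`.
  set δ : ℝ := ε ^ (1 / r) with hδ
  have hδ0 : 0 < δ := by positivity
  have hδr : δ ^ r = ε := by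
    rw [hδ, ← Real.rpow_mul hε.le, one_div_mul_cancel hr0.ne', Real.rpow_one]
  refine ⟨(1 / δ) ^ q, by positivity, fun J a b => ?_⟩
  have h1 := Real.young_inequality_of_nonneg (a := 1 / δ * |J|) (b := δ * |a * b|)
    (by positivity) (by positivity) hconj
  have h2 : (1 / δ * |J|) * (δ * |a * b|) = |J * (a * b)| := by
    rw [abs_mul J]
    field_simp
  rw [h2, Real.mul_rpow (by positivity) (abs_nonneg _), Real.mul_rpow hδ0.le (abs_nonneg _),
    hδr] at h1
  have h3 : |a * b| ^ r ≤ |a| ^ (2 * r) + |b| ^ (2 * r) := by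
    have h4 (a b : ℝ) (h : |a| ≤ |b|) : |a * b| ^ r ≤ |b| ^ (2 * r) := by
      rw [Real.rpow_mul (abs_nonneg b), Real.rpow_two]
      refine Real.rpow_le_rpow (abs_nonneg _) ?_ hr0.le
      rw [abs_mul, sq]
      exact mul_le_mul_of_nonneg_right h (abs_nonneg _)
    have ha : 0 ≤ |a| ^ (2 * r) := by positivity
    have hb : 0 ≤ |b| ^ (2 * r) := by positivity
    rcases le_total |a| |b| with h | h
    · linarith [h4 a b h]
    · have := h4 b a h
      rw [mul_comm b a] at this
      linarith
  rw [hp]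
  have h5 : (1 / δ) ^ q * |J| ^ q / q ≤ (1 / δ) ^ q * |J| ^ q :=
    div_le_self (by positivity) hq.le
  have h6 : ε * |a * b| ^ r / r ≤ ε * |a * b| ^ r := div_le_self (by positivity) hr1.le
  have h7 : ε * |a * b| ^ r ≤ ε * (|a| ^ (2 * r) + |b| ^ (2 * r)) :=
    mul_le_mul_of_nonneg_left h3 hε.le
  linarith

theorem card_nbrs_le (x : Site d) : (nbrs x).card ≤ 3 ^ d := by
  have hsub : nbrs x ⊆ Finset.Icc (x - 1) (x + 1) := by
    intro y hy
    rw [mem_nbrs] at hy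
    have hy' : ∑ i, |x i - y i| = 1 := hy
    have h (i : Fin d) : |x i - y i| ≤ 1 :=
      hy' ▸ Finset.single_le_sum (f := fun i => |x i - y i|) (fun j _ => abs_nonneg _)
        (Finset.mem_univ i)
    rw [Finset.mem_Icc]
    constructor <;> intro i <;> have := abs_le.1 (h i) <;> simp <;> linarith
  refine (Finset.card_le_card hsub).trans (le_of_eq ?_)
  have h (i : Fin d) : (Finset.Icc ((x - 1) i) ((x + 1) i)).card = 3 := by
    rw [Int.card_Icc]
    simp only [Pi.add_apply, Pi.sub_apply, Pi.one_apply]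
    omega
  rw [Pi.card_Icc, Finset.prod_congr rfl fun i _ => h i]
  simp

theorem energy_singleton_update (x : Site d) (J : Edge d → ℝ) (η : Config d) (u : ℝ) :
    energy {x} J (Function.update η x u) = ∑ y ∈ nbrs x, coupling J s(x, y) * (u * η y) := by
  rw [energy, incident, Finset.singleton_biUnion, Finset.sum_image]
  · refine Finset.sum_congr rfl fun y hy => ?_
    have hne : y ≠ x := ((lattice d).ne_of_adj (mem_nbrs.1 hy)).symm
    rw [edgeTerm_mk, Function.update_self, Function.update_of_ne hne]
  · intro y _ y' _ h
    rcases Sym2.eq_iff.1 h with ⟨-, h⟩ | ⟨h1, h2⟩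
    · exact h
    · exact h2.trans h1

/-- The bound on the single-site energy which follows from Young's inequality. -/
def siteBound (q A ε : ℝ) (J : Edge d → ℝ) (η : Config d) (x : Site d) : ℝ :=
  ∑ y ∈ nbrs x, (A * |coupling J s(x, y)| ^ q + ε * |η y| ^ (2 * q / (q - 1)))

theorem siteBound_nonneg {q A ε : ℝ} (hA : 0 ≤ A) (hε : 0 < ε) (J : Edge d → ℝ) (η : Config d)
    (x : Site d) : 0 ≤ siteBound q A ε J η x :=
  Finset.sum_nonneg fun _ _ => by positivity

theorem abs_energy_singleton_update_le {q A ε : ℝ} (hε : 0 < ε)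
    (hA : ∀ J a b : ℝ, |J * (a * b)| ≤ A * |J| ^ q +
      (ε * |a| ^ (2 * q / (q - 1)) + ε * |b| ^ (2 * q / (q - 1))))
    (x : Site d) (J : Edge d → ℝ) (η : Config d) (u : ℝ) :
    |energy {x} J (Function.update η x u)| ≤
      siteBound q A ε J η x + 3 ^ d * ε * |u| ^ (2 * q / (q - 1)) := by
  rw [energy_singleton_update]
  refine (Finset.abs_sum_le_sum_abs _ _).trans ?_
  have h1 : ∑ y ∈ nbrs x, |coupling J s(x, y) * (u * η y)| ≤
      ∑ y ∈ nbrs x, ((A * |coupling J s(x, y)| ^ q + ε * |η y| ^ (2 * q / (q - 1))) +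
        ε * |u| ^ (2 * q / (q - 1))) :=
    Finset.sum_le_sum fun y _ => (hA _ _ _).trans (le_of_eq (by ring))
  refine h1.trans ?_
  rw [Finset.sum_add_distrib, Finset.sum_const, nsmul_eq_mul, mul_assoc]
  refine add_le_add le_rfl (mul_le_mul_of_nonneg_right ?_ (by positivity))
  exact_mod_cast card_nbrs_le x

/-- The one-point estimate: under the single-site kernel, the `p`-th moment of the spin is
controlled by those of the neighbouring spins, with an arbitrarily small prefactor. -/
theorem exists_lintegral_gibbsKernel_singleton_le {q : ℝ} (hq : 1 < q)
    {χ : Site d → ProbabilityMeasure ℝ} (hχ : SingleSpinClass q χ) {ε : ℝ} (hε : 0 < ε) :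
    ∃ A K : ℝ, 0 ≤ A ∧ 0 ≤ K ∧ ∀ (x : Site d) (J : Edge d → ℝ) (η : Config d),
      ∫⁻ ζ, ENNReal.ofReal (|ζ x| ^ (2 * q / (q - 1))) ∂gibbsKernel χ {x} J η ≤
        ENNReal.ofReal (K + siteBound q A ε J η x) := by
  -- Half of `ε`, because the site bound `b` enters twice below: from the numerator and from the
  -- partition function.
  have hε2 : 0 < ε / 2 := by positivity
  obtain ⟨A, hA0, hA⟩ := exists_abs_mul_mul_le hq hε2
  set p : ℝ := 2 * q / (q - 1) with hp
  set c : ℝ := 3 ^ d * (ε / 2) with hc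
  have hc0 : 0 < c := by positivity
  -- The exponent `c + 1` covers `c * |u| ^ p` from the energy and one further `|u| ^ p` used to
  -- control the moment.
  set Cp := ⨆ x, ∫⁻ u, ENNReal.ofReal (Real.exp ((c + 1) * |u| ^ p)) ∂(χ x : Measure ℝ) with hCp
  set Cm := ⨅ x, ∫⁻ u, ENNReal.ofReal (Real.exp (-(c * |u| ^ p))) ∂(χ x : Measure ℝ) with hCm
  have hCp' : Cp < ∞ := (hχ (c + 1) (by positivity)).1
  have hCm' : 0 < Cm := (hχ c hc0).2
  set K : ℝ := (Cp / Cm).toReal with hK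
  have hK0 : 0 ≤ K := ENNReal.toReal_nonneg
  have hratio : Cp ≤ ENNReal.ofReal (Real.exp K) * Cm := by
    have hfin : Cp / Cm ≠ ∞ := ENNReal.div_ne_top hCp'.ne hCm'.ne'
    refine ENNReal.div_le_iff_le_mul (.inl hCm'.ne') (.inr (by simp [Real.exp_pos])) |>.1 ?_
    rw [← ENNReal.ofReal_toReal hfin]
    exact ENNReal.ofReal_le_ofReal (by linarith [Real.add_one_le_exp K])
  refine ⟨2 * A, K + 1, by positivity, by positivity, fun x J η => ?_⟩
  set b : ℝ := siteBound q A (ε / 2) J η x with hb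
  have hb0 : 0 ≤ b := siteBound_nonneg hA0 hε2 J η x
  have h2b : siteBound q (2 * A) ε J η x = 2 * b := by
    rw [hb, siteBound, siteBound, Finset.mul_sum]
    exact Finset.sum_congr rfl fun y _ => by ring
  -- Chosen so that `exp (-t) * exp b * exp K = exp (-b)`, the factor in the lower bound for the
  -- partition function.
  set t : ℝ := K + 2 * b with ht
  have ht0 : 0 ≤ t := by positivity
  let E : ℝ → ℝ := fun u => energy {x} J (Function.update η x u)
  have hE (u : ℝ) : |E u| ≤ b + c * |u| ^ p :=
    abs_energy_singleton_update_le hε2 hA x J η u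
  have hEm : Measurable E := (measurable_energy {x} J).comp (measurable_update η)
  have hm : Measurable fun ζ : Config d => ENNReal.ofReal (|ζ x| ^ p) := by fun_prop
  have hZ : partition χ {x} J η = ∫⁻ u, ENNReal.ofReal (Real.exp (E u)) ∂(χ x : Measure ℝ) := by
    rw [partition, lmarginal_singleton]
    rfl
  have hW : weighted χ {x} J (fun ζ => ENNReal.ofReal (|ζ x| ^ p)) η =
      ∫⁻ u, ENNReal.ofReal (Real.exp (E u)) * ENNReal.ofReal (|u| ^ p) ∂(χ x : Measure ℝ) := by
    rw [weighted, lmarginal_singleton]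
    simp only [Function.update_self]
    rfl
  have hlow : ENNReal.ofReal (Real.exp (-b)) * Cm ≤ partition χ {x} J η := by
    rw [hZ]
    refine (mul_le_mul_right (iInf_le _ x) _).trans ?_
    rw [← lintegral_const_mul' _ _ ENNReal.ofReal_ne_top]
    refine lintegral_mono fun u => ?_
    simp only
    rw [← ENNReal.ofReal_mul (Real.exp_pos _).le, ← Real.exp_add]
    refine ENNReal.ofReal_le_ofReal (Real.exp_le_exp.2 ?_)
    linarith [(abs_le.1 (hE u)).1]
  have hup : ∫⁻ u, ENNReal.ofReal (Real.exp (E u + |u| ^ p)) ∂(χ x : Measure ℝ) ≤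
      ENNReal.ofReal (Real.exp b) * Cp := by
    refine le_trans ?_ (mul_le_mul_right (le_iSup (fun x => ∫⁻ u, ENNReal.ofReal
      (Real.exp ((c + 1) * |u| ^ p)) ∂(χ x : Measure ℝ)) x) _)
    rw [← lintegral_const_mul' _ _ ENNReal.ofReal_ne_top]
    refine lintegral_mono fun u => ?_
    simp only
    rw [← ENNReal.ofReal_mul (Real.exp_pos _).le, ← Real.exp_add]
    refine ENNReal.ofReal_le_ofReal (Real.exp_le_exp.2 ?_)
    linarith [(abs_le.1 (hE u)).2]
  -- Pointwise `s ≤ t + exp (s - t)` with `s = |u| ^ p`; the exponential part integrates to at most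
  -- one partition function.
  have hsplit : weighted χ {x} J (fun ζ => ENNReal.ofReal (|ζ x| ^ p)) η ≤
      ENNReal.ofReal t * partition χ {x} J η + partition χ {x} J η := by
    have h1 : weighted χ {x} J (fun ζ => ENNReal.ofReal (|ζ x| ^ p)) η ≤
        ∫⁻ u, (ENNReal.ofReal t * ENNReal.ofReal (Real.exp (E u)) +
          ENNReal.ofReal (Real.exp (-t)) * ENNReal.ofReal (Real.exp (E u + |u| ^ p)))
          ∂(χ x : Measure ℝ) := by
      rw [hW]
      refine lintegral_mono fun u => ?_
      simp only
      have hup0 : 0 ≤ |u| ^ p := by positivity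
      rw [← ENNReal.ofReal_mul (Real.exp_pos _).le, ← ENNReal.ofReal_mul ht0,
        ← ENNReal.ofReal_mul (Real.exp_pos _).le, ← ENNReal.ofReal_add (by positivity)
        (by positivity)]
      refine ENNReal.ofReal_le_ofReal ?_
      have h2 : Real.exp (-t) * Real.exp (E u + |u| ^ p) =
          Real.exp (E u) * Real.exp (|u| ^ p - t) := by
        rw [← Real.exp_add, ← Real.exp_add]
        ring_nf
      rw [h2]
      have h3 := Real.add_one_le_exp (|u| ^ p - t)
      have h4 : |u| ^ p ≤ t + Real.exp (|u| ^ p - t) := by linarith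
      have h5 := mul_le_mul_of_nonneg_left h4 (Real.exp_pos (E u)).le
      linarith
    refine h1.trans ?_
    rw [lintegral_add_left (by fun_prop),
      lintegral_const_mul' _ _ ENNReal.ofReal_ne_top,
      lintegral_const_mul' _ _ ENNReal.ofReal_ne_top, ← hZ]
    refine add_le_add le_rfl ?_
    calc ENNReal.ofReal (Real.exp (-t)) *
          ∫⁻ u, ENNReal.ofReal (Real.exp (E u + |u| ^ p)) ∂(χ x : Measure ℝ)
        ≤ ENNReal.ofReal (Real.exp (-t)) * (ENNReal.ofReal (Real.exp b) *
          (ENNReal.ofReal (Real.exp K) * Cm)) := by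
          exact mul_le_mul_right (hup.trans (mul_le_mul_right hratio _)) _
      _ = ENNReal.ofReal (Real.exp (-b)) * Cm := by
          rw [← mul_assoc, ← mul_assoc, ← ENNReal.ofReal_mul (Real.exp_pos _).le,
            ← ENNReal.ofReal_mul (by positivity), ← Real.exp_add, ← Real.exp_add]
          congr 3
          rw [ht]
          ring
      _ ≤ partition χ {x} J η := hlow
  rw [lintegral_gibbsKernel hq hχ {x} J η hm]
  refine ENNReal.div_le_of_le_mul (hsplit.trans (le_of_eq ?_))
  rw [h2b, show K + 1 + 2 * b = t + 1 by rw [ht]; ring, ENNReal.ofReal_add ht0 zero_le_one,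
    ENNReal.ofReal_one, add_mul, one_mul]

/-- The `p`-th moments under the local Gibbs kernels are finite. -/
theorem lintegral_gibbsKernel_rpow_lt_top {q : ℝ} (hq : 1 < q)
    {χ : Site d → ProbabilityMeasure ℝ} (hχ : SingleSpinClass q χ) (Λ : Finset (Site d))
    (J : Edge d → ℝ) (ξ : Config d) {x : Site d} (hx : x ∈ Λ) :
    ∫⁻ ζ, ENNReal.ofReal (|ζ x| ^ (2 * q / (q - 1))) ∂gibbsKernel χ Λ J ξ < ∞ := by
  set p : ℝ := 2 * q / (q - 1) with hp
  have hp2 : 2 ≤ p := by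
    rw [hp, le_div_iff₀ (by linarith)]; linarith
  obtain ⟨C, hC, hle⟩ := exists_negEnergy_le Λ J ξ
  have hint1 (y : Site d) : Integrable (fun u : ℝ => Real.exp ((C + 1) * |u| ^ p))
      (χ y : Measure ℝ) := by
    refine ⟨Measurable.aestronglyMeasurable (by fun_prop), ?_⟩
    rw [hasFiniteIntegral_iff_ofReal (Eventually.of_forall fun u => (Real.exp_pos _).le)]
    exact (le_iSup (fun x => ∫⁻ u, ENNReal.ofReal (Real.exp ((C + 1) * |u| ^ p))
      ∂(χ x : Measure ℝ)) y).trans_lt (hχ (C + 1) (by positivity)).1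
  have hint := (Integrable.fintype_prod (f := fun (_ : Λ) (u : ℝ) =>
    Real.exp C * Real.exp ((C + 1) * |u| ^ p)) (μ := fun y : Λ => (χ y : Measure ℝ))
    (fun y => (hint1 y).const_mul _)).const_mul (Real.exp C)
  have hm : Measurable fun ζ : Config d => ENNReal.ofReal (|ζ x| ^ p) := by fun_prop
  rw [lintegral_gibbsKernel hq hχ Λ J ξ hm]
  refine ENNReal.div_lt_top (ne_of_lt ?_) (partition_ne_zero hq hχ Λ J ξ)
  refine lt_of_le_of_lt ?_ hint.lintegral_lt_top
  rw [weighted, lmarginal]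
  refine lintegral_mono fun σ => ?_
  change ENNReal.ofReal (Real.exp (energy Λ J (glue Λ ξ σ))) *
    ENNReal.ofReal (|glue Λ ξ σ x| ^ p) ≤ _
  rw [← negEnergy_eq_energy, ← ENNReal.ofReal_mul (Real.exp_pos _).le, glue_of_mem hx]
  refine ENNReal.ofReal_le_ofReal ?_
  -- The moment is absorbed into the exponential at the price of raising the exponent from `C` to `C
  -- + 1`.
  have h1 : |σ ⟨x, hx⟩| ^ p ≤ Real.exp (∑ y, |σ y| ^ p) := by
    have h2 := Finset.single_le_sum (f := fun y => |σ y| ^ p) (fun j _ => by positivity)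
      (Finset.mem_univ (⟨x, hx⟩ : Λ))
    linarith [Real.add_one_le_exp (∑ y, |σ y| ^ p)]
  refine (mul_le_mul_of_nonneg_left h1 (Real.exp_pos _).le).trans ?_
  simp only [← Real.exp_add, ← Real.exp_sum]
  refine Real.exp_le_exp.2 ?_
  have h3 : ∑ y, σ y ^ 2 ≤ ∑ y, (1 + |σ y| ^ p) := by
    refine Finset.sum_le_sum fun y _ => ?_
    rcases le_total |σ y| 1 with h | h
    · have h0 : 0 ≤ |σ y| ^ p := Real.rpow_nonneg (abs_nonneg _) _
      nlinarith [sq_abs (σ y), abs_nonneg (σ y)]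
    · have := Real.rpow_le_rpow_of_exponent_le h hp2
      rw [Real.rpow_two, sq_abs] at this
      linarith
  have h4 : ∑ y, (C + (C + 1) * |σ y| ^ p) = C * ∑ y, (1 + |σ y| ^ p) + ∑ y, |σ y| ^ p := by
    rw [Finset.mul_sum, ← Finset.sum_add_distrib]
    exact Finset.sum_congr rfl fun y _ => by ring
  have h5 := mul_le_mul_of_nonneg_left h3 hC.le
  linarith [hle σ]

/-- Tonelli and symmetry of adjacency. In the moment estimate it moves the neighbours' moments back
to the central site. -/
theorem tsum_sum_nbrs_comm (f : Site d → Site d → ℝ≥0∞) :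
    ∑' x, ∑ y ∈ nbrs x, f x y = ∑' x, ∑ y ∈ nbrs x, f y x := by
  classical
  have h (g : Site d → Site d → ℝ≥0∞) (x : Site d) :
      ∑ y ∈ nbrs x, g x y = ∑' y, if (lattice d).Adj x y then g x y else 0 := by
    rw [tsum_eq_sum (s := nbrs x) fun y hy => if_neg fun h => hy (mem_nbrs.2 h)]
    exact Finset.sum_congr rfl fun y hy => (if_pos (mem_nbrs.1 hy)).symm
  simp only [h f, h fun x y => f y x]
  rw [ENNReal.tsum_comm]
  simp only [(lattice d).adj_comm]

/-- A sum over oriented edges is controlled by the sum over edges. -/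
theorem tsum_sum_nbrs_coupling_ne_top {q : ℝ} {w : Site d → ℝ} (hw : IsWeight w)
    (J : Couplings q w) :
    ∑' x, ∑ y ∈ nbrs x, ENNReal.ofReal (w x) * ENNReal.ofReal (|coupling J s(x, y)| ^ q) ≠ ∞ := by
  classical
  let D : Type := {a : Site d × Site d // (lattice d).Adj a.1 a.2}
  let G : Edge d → ℝ≥0∞ := fun e => ENNReal.ofReal (|J e| ^ q * edgeWeight w e)
  have hG : ∑' e, G e ≠ ∞ := J.2.tsum_ofReal_ne_top
  -- The bit records whether the first endpoint is the chosen representative of the edge, so an edge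
  -- is counted at most twice.
  let φ : D → Edge d × Bool := fun a => (⟨s(a.1.1, a.1.2), a.2⟩,
    decide (a.1.1 = (Quot.out s(a.1.1, a.1.2)).1))
  have hφ : Function.Injective φ := by
    rintro ⟨⟨x, y⟩, h⟩ ⟨⟨x', y'⟩, h'⟩ hxy
    simp only [φ, Prod.mk.injEq, decide_eq_decide] at hxy
    obtain ⟨h1, h2⟩ := hxy
    replace h1 : s(x, y) = s(x', y') := congr_arg Subtype.val h1
    rw [← h1] at h2
    rcases Sym2.eq_iff.1 h1 with ⟨rfl, rfl⟩ | ⟨rfl, rfl⟩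
    · rfl
    · have hne : x ≠ y := (lattice d).ne_of_adj h
      have hout : (Quot.out s(x, y)).1 ∈ s(x, y) := Sym2.out_fst_mem _
      rcases Sym2.mem_iff.1 hout with h3 | h3
      · exact absurd ((h2.1 h3.symm).trans h3).symm hne
      · exact absurd ((h2.2 h3.symm).trans h3) hne
  have h1 : ∑' x, ∑ y ∈ nbrs x, ENNReal.ofReal (w x) * ENNReal.ofReal (|coupling J s(x, y)| ^ q) ≤
      ∑' a : D, G (φ a).1 := by
    let g : Site d × Site d → ℝ≥0∞ := fun a =>
      ENNReal.ofReal (w a.1) * ENNReal.ofReal (|coupling J s(a.1, a.2)| ^ q)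
    let T : Set (Site d × Site d) := {a | (lattice d).Adj a.1 a.2}
    have h2 (x : Site d) : ∑ y ∈ nbrs x, g (x, y) = ∑' y, T.indicator g (x, y) := by
      have h3 (y : Site d) (hy : y ∉ nbrs x) : T.indicator g (x, y) = 0 :=
        Set.indicator_of_notMem (s := T) (show (x, y) ∉ T from fun h => hy (mem_nbrs.2 h)) g
      rw [tsum_eq_sum h3]
      refine Finset.sum_congr rfl fun y hy => (Set.indicator_of_mem ?_ _).symm
      exact mem_nbrs.1 hy
    change ∑' x, ∑ y ∈ nbrs x, g (x, y) ≤ _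
    simp only [h2]
    rw [← ENNReal.tsum_prod (f := fun x y => T.indicator g (x, y)), ← tsum_subtype]
    refine ENNReal.tsum_le_tsum ?_
    rintro ⟨⟨x, y⟩, h⟩
    have hadj : (lattice d).Adj x y := h
    have hc : coupling J s(x, y) = J ⟨s(x, y), hadj⟩ := by
      have : s(x, y) ∈ (lattice d).edgeSet := hadj
      simp [coupling, this]
    simp only [g, G, φ, hc]
    rw [← ENNReal.ofReal_mul (hw.pos x).le, mul_comm]
    refine ENNReal.ofReal_le_ofReal (mul_le_mul_of_nonneg_left ?_ (by positivity))
    change w x ≤ w x + w y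
    linarith [hw.pos y]
  refine ne_top_of_le_ne_top ?_ (h1.trans
    (ENNReal.tsum_comp_le_tsum_of_injective hφ fun b => G b.1))
  rw [ENNReal.tsum_prod (f := fun e (_ : Bool) => G e)]
  simp only [tsum_bool]
  rw [ENNReal.tsum_add]
  exact ENNReal.add_ne_top.2 ⟨hG, hG⟩

/-- The weighted `p`-th power sum `∑ |σ(x)|^p w(x)`, with values in `[0, ∞]`. -/
def powerSum (p : ℝ) (w : Site d → ℝ) (σ : Config d) : ℝ≥0∞ :=
  ∑' x, ENNReal.ofReal (w x) * ENNReal.ofReal (|σ x| ^ p)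

theorem measurable_powerSum (p : ℝ) (w : Site d → ℝ) : Measurable (powerSum p w) :=
  Measurable.tsum fun x => by fun_prop

theorem powerSum_lt_top_iff {p : ℝ} {w : Site d → ℝ} (hw : IsWeight w) (σ : Config d) :
    powerSum p w σ < ∞ ↔ σ ∈ tempered p w := by
  have h0 (x : Site d) : 0 ≤ |σ x| ^ p * w x :=
    mul_nonneg (Real.rpow_nonneg (abs_nonneg _) _) (hw.pos x).le
  have h1 : powerSum p w σ = ∑' x, ENNReal.ofReal (|σ x| ^ p * w x) :=
    tsum_congr fun x => by rw [← ENNReal.ofReal_mul (hw.pos x).le, mul_comm]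
  rw [h1, lt_top_iff_ne_top]
  constructor
  · intro h
    have := ENNReal.summable_toReal h
    simp only [ENNReal.toReal_ofReal (h0 _)] at this
    exact this
  · exact fun h => Summable.tsum_ofReal_ne_top h

/-- The moment estimate: the weighted `p`-th moments of the local Gibbs kernels are bounded
uniformly in the volume. -/
theorem exists_lintegral_powerSum_gibbsKernel_le {q : ℝ} (hq : 1 < q)
    {χ : Site d → ProbabilityMeasure ℝ} (hχ : SingleSpinClass q χ) {w : Site d → ℝ}
    (hw : IsWeight w) (J : Couplings q w) {ξ : Config d}
    (hξ : ξ ∈ tempered (2 * q / (q - 1)) w) :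
    ∃ C : ℝ≥0∞, C ≠ ∞ ∧ ∀ Λ : Finset (Site d),
      ∫⁻ ζ, powerSum (2 * q / (q - 1)) w ζ ∂gibbsKernel χ Λ J ξ ≤ C := by
  obtain ⟨w₀, hw₀, hww⟩ := hw.exists_le_mul
  -- With degree at most `3 ^ d` and weight ratio at most `w₀`, this makes the neighbour terms
  -- contribute at most `W / 2`.
  set ε : ℝ := 1 / (2 * (w₀ * 3 ^ d)) with hε
  have hε0 : 0 < ε := by positivity
  obtain ⟨A, K, hA, hK, hone⟩ := exists_lintegral_gibbsKernel_singleton_le hq hχ hε0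
  set p : ℝ := 2 * q / (q - 1) with hp
  let ω : Site d → ℝ≥0∞ := fun x => ENNReal.ofReal (w x)
  let h : ℝ → ℝ≥0∞ := fun u => ENNReal.ofReal (|u| ^ p)
  have hh : Measurable h := by fun_prop
  let Q : Site d → ℝ≥0∞ := fun x => ∑ y ∈ nbrs x, ENNReal.ofReal (|coupling J s(x, y)| ^ q)
  set S : ℝ≥0∞ := ENNReal.ofReal K * ∑' x, ω x + ENNReal.ofReal A * ∑' x, ω x * Q x +
    powerSum p w ξ with hS
  have hVξ : powerSum p w ξ < ∞ := (powerSum_lt_top_iff hw ξ).2 hξ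
  have hSfin : S ≠ ∞ := by
    have h1 : ∑' x, ω x ≠ ∞ := hw.summable.tsum_ofReal_ne_top
    have h2 : ∑' x, ω x * Q x ≠ ∞ := by
      simp only [ω, Q, Finset.mul_sum]
      exact tsum_sum_nbrs_coupling_ne_top hw J
    finiteness
  refine ⟨2 * S, by finiteness, fun Λ => ?_⟩
  let m : Site d → ℝ≥0∞ := fun x => ∫⁻ ζ, h (ζ x) ∂gibbsKernel χ Λ J ξ
  have hmeas (x : Site d) : Measurable fun ζ : Config d => h (ζ x) :=
    hh.comp (measurable_pi_apply x)
  have hprob := isProbabilityMeasure_gibbsKernel hq hχ Λ J ξ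
  have hW : ∫⁻ ζ, powerSum p w ζ ∂gibbsKernel χ Λ J ξ = ∑' x, ω x * m x := by
    simp only [powerSum]
    rw [lintegral_tsum fun x => ((hmeas x).const_mul _).aemeasurable]
    exact tsum_congr fun x => lintegral_const_mul _ (hmeas x)
  rw [hW]
  set W := ∑' x, ω x * m x with hWdef
  have hout (x : Site d) (hx : x ∉ Λ) : m x = h (ξ x) :=
    lintegral_gibbsKernel_apply_of_notMem hq hχ Λ J ξ hh hx
  -- Consistency inserts the single-site kernel at `x`, to which the one-point estimate applies for
  -- every boundary condition.
  have hin (x : Site d) (hx : x ∈ Λ) : m x ≤ ENNReal.ofReal K + ENNReal.ofReal A * Q x +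
      ENNReal.ofReal ε * ∑ y ∈ nbrs x, m y := by
    have h1 : m x = ∫⁻ η, ∫⁻ ζ, h (ζ x) ∂gibbsKernel χ {x} J η ∂gibbsKernel χ Λ J ξ :=
      (lintegral_lintegral_gibbsKernel hq hχ (Finset.singleton_subset_iff.2 hx) J ξ
        (hmeas x)).symm
    have h2 (η : Config d) : ENNReal.ofReal (K + siteBound q A ε J η x) =
        ENNReal.ofReal K + ENNReal.ofReal A * Q x + ENNReal.ofReal ε * ∑ y ∈ nbrs x, h (η y) := by
      rw [ENNReal.ofReal_add hK (siteBound_nonneg hA hε0 _ _ _), siteBound,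
        ENNReal.ofReal_sum_of_nonneg fun y _ => by positivity, add_assoc, Finset.mul_sum,
        Finset.mul_sum, ← Finset.sum_add_distrib]
      congr 1
      refine Finset.sum_congr rfl fun y _ => ?_
      rw [ENNReal.ofReal_add (by positivity) (by positivity), ENNReal.ofReal_mul hA,
        ENNReal.ofReal_mul hε0.le]
    rw [h1]
    refine (lintegral_mono fun η => (hone x J η).trans (h2 η).le).trans (le_of_eq ?_)
    rw [lintegral_add_left measurable_const, lintegral_const, measure_univ, mul_one,
      lintegral_const_mul _ (Finset.measurable_sum _ fun y _ => hmeas y),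
      lintegral_finsetSum _ fun y _ => hmeas y]
  -- A priori finiteness is essential: only then can `W / 2` be subtracted from `W ≤ S + W / 2`.
  have hWfin : W ≠ ∞ := by
    have h1 (x : Site d) : ω x * m x ≤ ω x * h (ξ x) + if x ∈ Λ then ω x * m x else 0 := by
      by_cases hx : x ∈ Λ
      · simp [hx]
      · simp [hx, hout x hx]
    refine ne_top_of_le_ne_top ?_ (ENNReal.tsum_le_tsum h1)
    rw [ENNReal.tsum_add, tsum_eq_sum (s := Λ) fun x hx => if_neg hx]
    refine ENNReal.add_ne_top.2 ⟨hVξ.ne, ENNReal.sum_ne_top.2 fun x hx => ?_⟩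
    rw [if_pos hx]
    exact ENNReal.mul_ne_top ENNReal.ofReal_ne_top
      (lintegral_gibbsKernel_rpow_lt_top hq hχ Λ J ξ hx).ne
  have hnb : ∑' x, ∑ y ∈ nbrs x, ω x * m y ≤ ENNReal.ofReal (w₀ * 3 ^ d) * W := by
    calc ∑' x, ∑ y ∈ nbrs x, ω x * m y
        ≤ ∑' x, ∑ y ∈ nbrs x, ENNReal.ofReal w₀ * (ω y * m y) := by
          refine ENNReal.tsum_le_tsum fun x => Finset.sum_le_sum fun y hy => ?_
          rw [← mul_assoc]
          refine mul_le_mul_left ?_ _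
          rw [← ENNReal.ofReal_mul hw₀.le]
          exact ENNReal.ofReal_le_ofReal (hww x y (mem_nbrs.1 hy))
      _ = ∑' x, ∑ y ∈ nbrs x, ENNReal.ofReal w₀ * (ω x * m x) :=
          tsum_sum_nbrs_comm fun _ y => ENNReal.ofReal w₀ * (ω y * m y)
      _ ≤ ∑' x, ENNReal.ofReal (w₀ * 3 ^ d) * (ω x * m x) := by
          refine ENNReal.tsum_le_tsum fun x => ?_
          rw [Finset.sum_const, nsmul_eq_mul, ← mul_assoc, ENNReal.ofReal_mul hw₀.le,
            mul_comm (ENNReal.ofReal w₀)]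
          refine mul_le_mul_left (mul_le_mul_left ?_ _) _
          rw [← ENNReal.ofReal_natCast]
          exact ENNReal.ofReal_le_ofReal (by exact_mod_cast card_nbrs_le x)
      _ = _ := ENNReal.tsum_mul_left
  have hmain : W ≤ S + W / 2 := by
    have h1 (x : Site d) : ω x * m x ≤ (ENNReal.ofReal K * ω x + ENNReal.ofReal A * (ω x * Q x) +
        ω x * h (ξ x)) + ENNReal.ofReal ε * ∑ y ∈ nbrs x, ω x * m y := by
      by_cases hx : x ∈ Λ
      · refine (mul_le_mul_right (hin x hx) _).trans ?_
        rw [← Finset.mul_sum]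
        calc ω x * (ENNReal.ofReal K + ENNReal.ofReal A * Q x +
              ENNReal.ofReal ε * ∑ y ∈ nbrs x, m y)
            = ENNReal.ofReal K * ω x + ENNReal.ofReal A * (ω x * Q x) +
              ENNReal.ofReal ε * (ω x * ∑ y ∈ nbrs x, m y) := by ring
          _ ≤ _ := add_le_add le_self_add le_rfl
      · rw [hout x hx]
        exact le_add_right le_add_self
    refine (ENNReal.tsum_le_tsum h1).trans ?_
    rw [ENNReal.tsum_add, ENNReal.tsum_add, ENNReal.tsum_add, ENNReal.tsum_mul_left,
      ENNReal.tsum_mul_left, ENNReal.tsum_mul_left]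
    refine add_le_add le_rfl ((mul_le_mul_right hnb _).trans (le_of_eq ?_))
    rw [← mul_assoc, ← ENNReal.ofReal_mul hε0.le, ENNReal.div_eq_inv_mul]
    congr 1
    have : ε * (w₀ * 3 ^ d) = 2⁻¹ := by
      rw [hε]
      field_simp
    rw [this, ENNReal.ofReal_inv_of_pos (by norm_num)]
    simp
  have h2 : W / 2 ≤ S := by
    have h3 : W / 2 + W / 2 ≤ S + W / 2 := by rwa [ENNReal.add_halves]
    exact (ENNReal.add_le_add_iff_right (ENNReal.div_ne_top hWfin (by norm_num))).1 h3
  calc W = W / 2 + W / 2 := (ENNReal.add_halves W).symm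
    _ ≤ S + S := add_le_add h2 h2
    _ = 2 * S := (two_mul S).symm

end LatticeSpin
end

open scoped ProbabilityTheory

noncomputable section

/-- The integral of a bounded continuous function against a mixture of probability measures. -/
theorem integral_bind_boundedContinuous {α X : Type*} [MeasurableSpace α] [TopologicalSpace X]
    [MeasurableSpace X] [OpensMeasurableSpace X] (m : Measure α) [IsProbabilityMeasure m]
    {κ : α → Measure X} (hκ : Measurable κ) (h : ∀ a, IsProbabilityMeasure (κ a)) (f : X →ᵇ ℝ) :
    ∫ x, f x ∂(m.bind κ) = ∫ a, ∫ x, f x ∂κ a ∂m := by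
  let k : ProbabilityTheory.Kernel α X := ⟨κ, hκ⟩
  have _ : ProbabilityTheory.IsMarkovKernel k := ⟨h⟩
  have _ : IsProbabilityMeasure (m.bind κ) :=
    isProbabilityMeasure_bind hκ.aemeasurable (Eventually.of_forall h)
  have hc : (k ∘ₖ ProbabilityTheory.Kernel.const Unit m) () = m.bind κ := by
    rw [ProbabilityTheory.Kernel.comp_apply, ProbabilityTheory.Kernel.const_apply]
    rfl
  have hf : Integrable f ((k ∘ₖ ProbabilityTheory.Kernel.const Unit m) ()) := by
    rw [hc]
    exact f.integrable _
  have := ProbabilityTheory.Kernel.integral_comp hf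
  rwa [hc, ProbabilityTheory.Kernel.const_apply] at this

/-! ### Compactness from moment bounds -/

namespace LatticeSpin

variable {d : ℕ}

/-- Each coordinate is confined to a compact interval, so Tychonoff applies; closedness holds
because the power sum is a supremum of continuous finite sums. -/
theorem isCompact_powerSum_le {p : ℝ} (hp : 0 < p) {w : Site d → ℝ} (hw : IsWeight w)
    {r : ℝ≥0∞} (hr : r ≠ ∞) : IsCompact {σ : Config d | powerSum p w σ ≤ r} := by
  have hclosed : IsClosed {σ : Config d | powerSum p w σ ≤ r} := by
    simp only [powerSum, ENNReal.tsum_eq_iSup_sum, iSup_le_iff, Set.ofPred_forall]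
    refine isClosed_iInter fun A => isClosed_le (continuous_finsetSum _ fun x _ => ?_)
      continuous_const
    refine (ENNReal.continuous_const_mul ENNReal.ofReal_ne_top).comp
      (ENNReal.continuous_ofReal.comp ?_)
    exact (continuous_apply x).abs.rpow_const fun _ => .inr hp.le
  refine (isCompact_univ_pi fun x => isCompact_Icc (a := -(r.toReal / w x) ^ (1 / p))
    (b := (r.toReal / w x) ^ (1 / p))).of_isClosed_subset hclosed fun σ hσ x _ => ?_
  have h1 : ENNReal.ofReal (w x) * ENNReal.ofReal (|σ x| ^ p) ≤ r :=
    (ENNReal.le_tsum (f := fun x => ENNReal.ofReal (w x) * ENNReal.ofReal (|σ x| ^ p)) x).trans hσ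
  rw [← ENNReal.ofReal_mul (hw.pos x).le] at h1
  have h2 : w x * |σ x| ^ p ≤ r.toReal := (ENNReal.ofReal_le_iff_le_toReal hr).1 h1
  rw [Set.mem_Icc, ← abs_le]
  calc |σ x| = (|σ x| ^ p) ^ (1 / p) := by
        rw [← Real.rpow_mul (abs_nonneg _), mul_one_div_cancel hp.ne', Real.rpow_one]
    _ ≤ (r.toReal / w x) ^ (1 / p) := by
        refine Real.rpow_le_rpow (by positivity) ?_ (by positivity)
        rw [le_div_iff₀ (hw.pos x), mul_comm]
        exact h2

/-- The states with weighted `p`-th moment at most `C`. -/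
def momentSet (p : ℝ) (w : Site d → ℝ) (C : ℝ≥0∞) : Set (State d) :=
  {μ | ∫⁻ σ, powerSum p w σ ∂μ.toMeasure ≤ C}

/-- Portmanteau gives lower semicontinuity for each continuous finite partial sum, and monotone
convergence recovers the whole series. Sequences suffice because states form a metrizable space. -/
theorem isClosed_momentSet {p : ℝ} (hp : 0 < p) (w : Site d → ℝ) (hw : IsWeight w) (C : ℝ≥0∞) :
    IsClosed (momentSet p w C) := by
  refine IsSeqClosed.isClosed fun μs μ hμs hlim => ?_
  have hm (x : Site d) : Measurable fun σ : Config d =>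
      ENNReal.ofReal (w x) * ENNReal.ofReal (|σ x| ^ p) := by fun_prop
  change ∫⁻ σ, powerSum p w σ ∂μ.toMeasure ≤ C
  simp only [powerSum]
  rw [lintegral_tsum fun x => (hm x).aemeasurable, ENNReal.tsum_eq_iSup_sum]
  refine iSup_le fun A => ?_
  rw [← lintegral_finsetSum _ fun x _ => hm x]
  let f : Config d → ℝ := fun σ => ∑ x ∈ A, w x * |σ x| ^ p
  have h0 (σ : Config d) (x : Site d) : 0 ≤ w x * |σ x| ^ p :=
    mul_nonneg (hw.pos x).le (Real.rpow_nonneg (abs_nonneg _) _)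
  have hf (σ : Config d) : ∑ x ∈ A, ENNReal.ofReal (w x) * ENNReal.ofReal (|σ x| ^ p) =
      ENNReal.ofReal (f σ) := by
    rw [ENNReal.ofReal_sum_of_nonneg fun x _ => h0 σ x]
    exact Finset.sum_congr rfl fun x _ => (ENNReal.ofReal_mul (hw.pos x).le).symm
  have hcont : Continuous f := continuous_finsetSum _ fun x _ =>
    continuous_const.mul ((continuous_apply x).abs.rpow_const fun _ => .inr hp.le)
  simp only [hf]
  refine (lintegral_le_liminf_lintegral_of_forall_isOpen_measure_le_liminf_measure
    (μs := fun n => (μs n).toMeasure) hcont (fun σ => Finset.sum_nonneg fun x _ => h0 σ x)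
    fun G hG => ProbabilityMeasure.le_liminf_measure_open_of_tendsto (Ω := Config d)
      hlim hG).trans ?_
  refine liminf_le_of_le (by isBoundedDefault) fun b hb => ?_
  obtain ⟨n, hn⟩ := hb.exists
  refine hn.trans (le_trans (lintegral_mono fun σ => ?_) (hμs n))
  rw [← hf]
  exact ENNReal.sum_le_tsum A

/-- Markov's inequality bounds the mass outside the compact set `L n` by `C / (n + 1)`, which is the
uniform tightness needed for Prokhorov's theorem. -/
theorem isCompact_momentSet {p : ℝ} (hp : 0 < p) {w : Site d → ℝ} (hw : IsWeight w) {C : ℝ≥0∞}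
    (hC : C ≠ ∞) : IsCompact (momentSet p w C) := by
  lift C to NNReal using hC
  let L : ℕ → Set (Config d) := fun n => {σ | powerSum p w σ ≤ (n + 1 : ℕ)}
  have hK := isCompact_setOfPred_probabilityMeasure_mass_eq_compl_isCompact_le
    (E := Config d) (u := fun n : ℕ => C / (n + 1 : ℕ)) (K := L)
    ((tendsto_const_div_atTop_nhds_zero_nat C).comp (tendsto_add_atTop_nat 1))
    (fun n => isCompact_powerSum_le hp hw (ENNReal.natCast_ne_top _))
    (.inr fun m n hmn σ hσ => le_trans (show powerSum p w σ ≤ (m + 1 : ℕ) from hσ)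
      (by exact_mod_cast Nat.succ_le_succ hmn))
  refine IsCompact.of_isClosed_subset hK (isClosed_momentSet hp w hw C) fun μ hμ n => ?_
  have h1 : (L n)ᶜ ⊆ {σ | ((n + 1 : ℕ) : ℝ≥0∞) ≤ powerSum p w σ} := fun σ hσ =>
    (not_le.1 (show ¬ powerSum p w σ ≤ (n + 1 : ℕ) from hσ)).le
  have h2 : μ.toMeasure (L n)ᶜ ≤ ((C / (n + 1 : ℕ) : NNReal) : ℝ≥0∞) := by
    rw [ENNReal.coe_div (by positivity), ENNReal.coe_natCast,
      ENNReal.le_div_iff_mul_le (.inl (by simp)) (.inl (ENNReal.natCast_ne_top _)), mul_comm]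
    exact (mul_le_mul_right (measure_mono h1) _).trans
      ((mul_meas_ge_le_lintegral (measurable_powerSum p w) _).trans hμ)
  exact ENNReal.coe_le_coe.1
    ((ProbabilityMeasure.ennreal_coeFn_eq_coeFn_toMeasure (Ω := Config d) μ _).trans_le h2)

theorem momentSet_tempered {p : ℝ} {w : Site d → ℝ} (hw : IsWeight w) {C : ℝ≥0∞}
    (hC : C ≠ ∞) {μ : State d} (hμ : μ ∈ momentSet p w C) :
    μ.toMeasure (tempered p w) = 1 := by
  have h1 : ∀ᵐ σ ∂μ.toMeasure, σ ∈ tempered p w := by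
    filter_upwards [ae_lt_top (measurable_powerSum p w) (ne_top_of_le_ne_top hC hμ)] with σ hσ
    exact (powerSum_lt_top_iff hw σ).1 hσ
  exact (measure_congr (eventuallyEq_univ.2 h1)).trans measure_univ

theorem measurableSet_tempered (p : ℝ) {w : Site d → ℝ} (hw : IsWeight w) :
    MeasurableSet (tempered p w : Set (Config d)) := by
  have : (tempered p w : Set (Config d)) = {σ | powerSum p w σ < ∞} :=
    Set.ext fun σ => (powerSum_lt_top_iff hw σ).symm
  rw [this]
  exact measurableSet_lt (measurable_powerSum p w) measurable_const

/-! ### Gibbs property of limits and barycentres -/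

section Gibbs

variable {q : ℝ} {χ : Site d → ProbabilityMeasure ℝ}

theorem bind_gibbsKernel_of_subset (hq : 1 < q) (hχ : SingleSpinClass q χ)
    {Δ Λ : Finset (Site d)} (h : Δ ⊆ Λ) (J : Edge d → ℝ) (ξ : Config d) :
    (gibbsKernel χ Λ J ξ).bind (gibbsKernel χ Δ J) = gibbsKernel χ Λ J ξ := by
  refine Measure.ext fun A hA => ?_
  rw [Measure.bind_apply hA (measurable_gibbsKernel hq hχ Δ J).aemeasurable]
  have := lintegral_lintegral_gibbsKernel hq hχ h J ξ (measurable_one.indicator hA)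
  simpa only [lintegral_indicator_one hA] using this

/-- A weak limit point of the local Gibbs states satisfies the DLR equation. -/
theorem bind_gibbsKernel_of_tendsto (hq : 1 < q) (hχ : SingleSpinClass q χ)
    {D : ℕ → Finset (Site d)} (hD : IsCofinalSeq D) (J : Edge d → ℝ) (ξ : Config d)
    {l : Filter ℕ} [l.NeBot] (hl : l ≤ atTop) {μ : State d}
    (hμ : Tendsto (fun n => localGibbs hq hχ (D n) J ξ) l (𝓝 μ)) (Δ : Finset (Site d)) :
    μ.toMeasure.bind (gibbsKernel χ Δ J) = μ.toMeasure := by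
  have hprob := isProbabilityMeasure_gibbsKernel hq hχ Δ J
  have hmeas := measurable_gibbsKernel hq hχ Δ J
  have _ : IsProbabilityMeasure (μ.toMeasure.bind (gibbsKernel χ Δ J)) :=
    isProbabilityMeasure_bind hmeas.aemeasurable (Eventually.of_forall hprob)
  refine ext_of_forall_integral_eq_of_IsFiniteMeasure fun f => ?_
  rw [integral_bind_boundedContinuous _ hmeas hprob]
  -- Feller property: the kernel image of `f` is again bounded and continuous, so weak convergence
  -- may be tested on it.
  let g : Config d →ᵇ ℝ := BoundedContinuousFunction.ofNormedAddCommGroup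
    (fun η => ∫ ζ, f ζ ∂gibbsKernel χ Δ J η)
    ((continuous_integral_gibbsKernel hq hχ Δ f).comp (continuous_const.prodMk continuous_id)) ‖f‖
    fun η => f.norm_integral_le_norm _
  have hev : ∀ᶠ n in atTop, Δ ⊆ D n := by
    have h1 : ∀ᶠ n in atTop, ∀ x ∈ Δ, x ∈ D n := by
      rw [Filter.eventually_all_finset]
      intro x _
      obtain ⟨n, hn⟩ := hD.exhausting x
      filter_upwards [eventually_ge_atTop n] with k hk
      exact hD.mono hk hn
    exact h1
  have hlim (f : Config d →ᵇ ℝ) : Tendsto (fun n => ∫ ζ, f ζ ∂gibbsKernel χ (D n) J ξ) l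
      (𝓝 (∫ ζ, f ζ ∂μ.toMeasure)) :=
    ProbabilityMeasure.tendsto_iff_forall_integral_tendsto.1 hμ f
  refine tendsto_nhds_unique (hlim g) ((hlim f).congr' ?_)
  filter_upwards [hl hev] with n hn
  have _ := isProbabilityMeasure_gibbsKernel hq hχ (D n) J ξ
  -- Once `D n` contains `Δ`, the local state is exactly invariant under the kernel of `Δ`; the DLR
  -- equation is the limit of this identity.
  conv_lhs => rw [← bind_gibbsKernel_of_subset hq hχ hn J ξ]
  exact integral_bind_boundedContinuous _ hmeas hprob f

theorem mem_gibbsStates_of_bind {p : ℝ} {w : Site d → ℝ} (hq : 1 < q) (hχ : SingleSpinClass q χ)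
    {J : Edge d → ℝ} {μ : State d} (h1 : μ.toMeasure (tempered p w) = 1)
    (h2 : ∀ Δ : Finset (Site d), Δ.Nonempty → μ.toMeasure.bind (gibbsKernel χ Δ J) = μ.toMeasure) :
    μ ∈ gibbsStates p w χ J := by
  refine ⟨h1, fun Δ hΔ A hA => ?_⟩
  rw [← Measure.bind_apply hA (measurable_gibbsKernel hq hχ Δ J).aemeasurable, h2 Δ hΔ]

/-- The barycentre of a law on states. -/
def barycentre (m : StateLaw d) : State d :=
  (⟨m.toMeasure.bind State.toMeasure, isProbabilityMeasure_bind
    (measurable_state_toMeasure d).aemeasurable (Eventually.of_forall fun _ => inferInstance)⟩ :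
    ProbabilityMeasure (Config d))

theorem barycentre_toMeasure (m : StateLaw d) :
    (barycentre m).toMeasure = m.toMeasure.bind State.toMeasure := rfl

theorem integral_barycentre (m : StateLaw d) (f : Config d →ᵇ ℝ) :
    ∫ σ, f σ ∂(barycentre m).toMeasure =
      ∫ μ : State d, (∫ σ, f σ ∂μ.toMeasure) ∂m.toMeasure :=
  integral_bind_boundedContinuous _ (measurable_state_toMeasure d) (fun _ => inferInstance) f

theorem continuous_barycentre : Continuous (barycentre (d := d)) := by
  refine continuous_state_iff.2 fun f => ?_
  simp only [integral_barycentre]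
  let g : State d →ᵇ ℝ := BoundedContinuousFunction.ofNormedAddCommGroup
    (fun μ => ∫ σ, f σ ∂μ.toMeasure) (continuous_state_iff.1 continuous_id f) ‖f‖
    fun μ => f.norm_integral_le_norm _
  exact continuous_stateLaw_iff.1 continuous_id g

/-- Temperedness and the DLR equation are linear in the state, so they survive mixing. -/
theorem barycentre_mem_gibbsStates {p : ℝ} {w : Site d → ℝ} (hw : IsWeight w) (hq : 1 < q)
    (hχ : SingleSpinClass q χ) {J : Edge d → ℝ} {m : StateLaw d}
    (hm : ∀ᵐ μ ∂m.toMeasure, μ ∈ gibbsStates p w χ J) :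
    barycentre m ∈ gibbsStates p w χ J := by
  have hst := measurable_state_toMeasure d
  constructor
  · rw [barycentre_toMeasure, Measure.bind_apply (measurableSet_tempered p hw) hst.aemeasurable]
    rw [lintegral_congr_ae (hm.mono fun μ hμ => hμ.1), lintegral_const, measure_univ, mul_one]
  · intro Δ hΔ A hA
    have hk : Measurable fun η => gibbsKernel χ Δ J η A :=
      (Measure.measurable_coe hA).comp (measurable_gibbsKernel hq hχ Δ J)
    rw [barycentre_toMeasure, Measure.lintegral_bind hst.aemeasurable hk.aemeasurable,
      Measure.bind_apply hA hst.aemeasurable]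
    exact lintegral_congr_ae (hm.mono fun μ hμ => hμ.2 Δ hΔ A hA)

theorem integral_empiricalMetastate (hq : 1 < q) (hχ : SingleSpinClass q χ)
    (D : ℕ → Finset (Site d)) (ξ : Config d) (N : ℕ) (J : Edge d → ℝ) (F : State d →ᵇ ℝ) :
    ∫ μ, F μ ∂(empiricalMetastate hq hχ D ξ N J).toMeasure =
      (∑ n ∈ Finset.range (N + 1), F (localGibbs hq hχ (D n) J ξ)) / ((N + 1 : ℕ) : ℝ) := by
  change ∫ μ, F μ ∂((N + 1 : ℝ≥0∞)⁻¹ • ∑ n ∈ Finset.range (N + 1),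
    Measure.dirac (localGibbs hq hχ (D n) J ξ)) = _
  rw [integral_smul_measure, integral_finsetSum_measure fun n _ => F.integrable _]
  simp only [integral_dirac]
  rw [ENNReal.toReal_inv, smul_eq_mul, div_eq_inv_mul]
  congr 2
  exact_mod_cast ENNReal.toReal_natCast (N + 1)

theorem empiricalMetastate_apply (hq : 1 < q) (hχ : SingleSpinClass q χ)
    (D : ℕ → Finset (Site d)) (ξ : Config d) (N : ℕ) (J : Edge d → ℝ) {A : Set (State d)}
    (hA : MeasurableSet A) : (empiricalMetastate hq hχ D ξ N J).toMeasure A =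
      (N + 1 : ℝ≥0∞)⁻¹ * ∑ n ∈ Finset.range (N + 1),
        A.indicator 1 (localGibbs hq hχ (D n) J ξ) := by
  change ((N + 1 : ℝ≥0∞)⁻¹ • ∑ n ∈ Finset.range (N + 1),
    Measure.dirac (localGibbs hq hχ (D n) J ξ)) A = _
  simp only [Measure.smul_apply, Measure.coe_finsetSum, Finset.sum_apply,
    Measure.dirac_apply' _ hA, smul_eq_mul]

theorem continuous_empiricalMetastate (hq : 1 < q) (hχ : SingleSpinClass q χ)
    (D : ℕ → Finset (Site d)) (ξ : Config d) (N : ℕ) :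
    Continuous fun J : Edge d → ℝ => empiricalMetastate hq hχ D ξ N J := by
  refine continuous_stateLaw_iff.2 fun F => ?_
  simp only [integral_empiricalMetastate]
  exact (continuous_finsetSum _ fun n _ =>
    F.continuous.comp (continuous_localGibbs hq hχ (D n) ξ)).div_const _

/-- A weak limit of empirical metastates is carried by the limit points of the local Gibbs
states. -/
theorem ae_mem_closure_of_tendsto_empiricalMetastate (hq : 1 < q) (hχ : SingleSpinClass q χ)
    (D : ℕ → Finset (Site d)) (ξ : Config d) (J : Edge d → ℝ) {m : StateLaw d}
    (hm : Tendsto (fun N => empiricalMetastate hq hχ D ξ N J) atTop (𝓝 m)) (M : ℕ) :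
    ∀ᵐ μ ∂m.toMeasure, μ ∈ closure ((fun n => localGibbs hq hχ (D n) J ξ) '' Set.Ici M) := by
  set F := closure ((fun n => localGibbs hq hχ (D n) J ξ) '' Set.Ici M) with hF
  have hopen : IsOpen Fᶜ := isClosed_closure.isOpen_compl
  have h1 := ProbabilityMeasure.le_liminf_measure_open_of_tendsto (Ω := State d) hm hopen
  -- Only the first `M` terms can lie outside the closed tail, and their share of the average
  -- vanishes as `N` grows.
  have h2 (N : ℕ) : (empiricalMetastate hq hχ D ξ N J).toMeasure Fᶜ ≤
      (M : ℝ≥0∞) * ((N + 1 : ℕ) : ℝ≥0∞)⁻¹ := by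
    rw [empiricalMetastate_apply hq hχ D ξ N J hopen.measurableSet, mul_comm]
    push_cast
    refine mul_le_mul_left ?_ _
    have h3 (n : ℕ) : Fᶜ.indicator (1 : State d → ℝ≥0∞) (localGibbs hq hχ (D n) J ξ) ≤
        if n < M then 1 else 0 := by
      split_ifs with h
      · exact Set.indicator_le_self' (by simp) _
      · rw [Set.indicator_of_notMem]
        exact fun hn => hn (subset_closure ⟨n, not_lt.1 h, rfl⟩)
    refine (Finset.sum_le_sum fun n _ => h3 n).trans ?_
    rw [← Finset.sum_filter, Finset.sum_const, nsmul_one]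
    refine Nat.cast_le.2 ?_
    conv_rhs => rw [← Finset.card_range M]
    exact Finset.card_le_card fun n hn => Finset.mem_range.2 (Finset.mem_filter.1 hn).2
  have h4 : Tendsto (fun N : ℕ => (M : ℝ≥0∞) * ((N + 1 : ℕ) : ℝ≥0∞)⁻¹) atTop (𝓝 0) := by
    have := ENNReal.Tendsto.const_mul (a := (M : ℝ≥0∞))
      (ENNReal.tendsto_inv_nat_nhds_zero.comp (tendsto_add_atTop_nat 1))
      (.inr (ENNReal.natCast_ne_top M))
    simpa using this
  have h5 : m.toMeasure Fᶜ ≤ 0 := by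
    refine h1.trans ?_
    rw [← h4.liminf_eq]
    exact liminf_le_liminf (Eventually.of_forall h2)
  exact mem_ae_iff.2 (le_antisymm h5 zero_le)

theorem localGibbs_mem_momentSet (hq : 1 < q) (hχ : SingleSpinClass q χ) {w : Site d → ℝ}
    (hw : IsWeight w) (J : Couplings q w) {ξ : Config d}
    (hξ : ξ ∈ tempered (2 * q / (q - 1)) w) :
    ∃ C : ℝ≥0∞, C ≠ ∞ ∧ ∀ Λ : Finset (Site d),
      localGibbs hq hχ Λ J ξ ∈ momentSet (2 * q / (q - 1)) w C :=
  exists_lintegral_powerSum_gibbsKernel_le hq hχ hw J hξ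

/-- A weak limit of empirical metastates is carried by the tempered Gibbs states. -/
theorem ae_mem_gibbsStates_of_tendsto_empiricalMetastate (hq : 1 < q) (hχ : SingleSpinClass q χ)
    {w : Site d → ℝ} (hw : IsWeight w) {D : ℕ → Finset (Site d)} (hD : IsCofinalSeq D)
    {ξ : Config d} (hξ : ξ ∈ tempered (2 * q / (q - 1)) w) (J : Couplings q w) {m : StateLaw d}
    (hm : Tendsto (fun N => empiricalMetastate hq hχ D ξ N J) atTop (𝓝 m)) :
    ∀ᵐ μ ∂m.toMeasure, μ ∈ gibbsStates (2 * q / (q - 1)) w χ J := by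
  have hp : 0 < 2 * q / (q - 1) := div_pos (by linarith) (by linarith)
  obtain ⟨C, hC, hmem⟩ := localGibbs_mem_momentSet hq hχ hw J hξ
  have h1 := ae_all_iff.2 fun M =>
    ae_mem_closure_of_tendsto_empiricalMetastate hq hχ D ξ J hm M
  filter_upwards [h1] with μ hμ
  have hμC : μ ∈ momentSet (2 * q / (q - 1)) w C := by
    refine closure_minimal ?_ (isClosed_momentSet hp w hw C) (hμ 0)
    rintro _ ⟨n, -, rfl⟩
    exact hmem (D n)
  -- A point in the closure of every tail is a cluster point, hence a limit along some ultrafilter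
  -- finer than `atTop`.
  have hcl : MapClusterPt μ atTop fun n => localGibbs hq hχ (D n) J ξ := by
    rw [mapClusterPt_iff_frequently]
    intro s hs
    rw [frequently_atTop]
    intro M
    obtain ⟨_, h2, n, hn, rfl⟩ := mem_closure_iff_nhds.1 (hμ M) s hs
    exact ⟨n, hn, h2⟩
  obtain ⟨U, hU, hUμ⟩ := mapClusterPt_iff_ultrafilter.1 hcl
  exact mem_gibbsStates_of_bind hq hχ (momentSet_tempered hw hC hμC) fun Δ _ =>
    bind_gibbsKernel_of_tendsto hq hχ hD J ξ hU hUμ Δ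

end Gibbs

/-! ### Boxes and the conclusion -/

/-- The boxes `[-n, n]^d`. -/
def box (d n : ℕ) : Finset (Site d) := Finset.Icc (fun _ => -(n : ℤ)) fun _ => (n : ℤ)

theorem isCofinalSeq_box_comp (d : ℕ) {φ : ℕ → ℕ} (hφ : StrictMono φ) :
    IsCofinalSeq fun n => box d (φ n) where
  nonempty n := ⟨0, by simp [box, Finset.mem_Icc, Pi.le_def]⟩
  mono m n h := by
    have : (φ m : ℤ) ≤ φ n := by exact_mod_cast hφ.monotone h
    exact Finset.Icc_subset_Icc (fun _ => neg_le_neg this) fun _ => this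
  exhausting x := by
    refine ⟨∑ i, (x i).natAbs, ?_⟩
    have h1 (i : Fin d) : (x i).natAbs ≤ φ (∑ i, (x i).natAbs) :=
      (Finset.single_le_sum (f := fun i => (x i).natAbs) (fun _ _ => Nat.zero_le _)
        (Finset.mem_univ i)).trans hφ.le_apply
    rw [box, Finset.mem_Icc]
    constructor <;> intro i <;> have := h1 i <;> simp only <;> omega

end LatticeSpin
end

theorem theorem4 (d : ℕ) (hd : 0 < d) (q p : ℝ) (hq : 1 < q) (hp : p = 2 * q / (q - 1))
    (w : Site d → ℝ) (hw : IsWeight w)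
    (χ : Site d → ProbabilityMeasure ℝ) (hχ : SingleSpinClass q χ)
    (ν : Measure (Couplings q w)) [IsProbabilityMeasure ν]
    (ξ : Config d) (hξ : ξ ∈ tempered p w) :
    ∃ (m : Couplings q w → StateLaw d) (D : ℕ → Finset (Site d)),
      IsMetastate p χ ν m ∧ IsCofinalSeq D ∧
      ∀ᵐ J : Couplings q w ∂ν, Tendsto (fun N : ℕ => empiricalMetastate hq hχ D ξ N J) atTop (𝓝 (m J)) := by
  subst hp
  have hp0 : 0 < 2 * q / (q - 1) := div_pos (by linarith) (by linarith)
  obtain ⟨F, hF⟩ := exists_seq_boundedContinuous_separating (isEmbedding_stateEmbedding d)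
  have hJ := continuous_couplings_apply hq hw
  obtain ⟨φ, hφ, hlim⟩ := exists_strictMono_ae_tendsto_average ν
    (fun k n (J : Couplings q w) => F k (localGibbs hq hχ (box d n) J ξ))
    (fun k n => ((F k).continuous.comp
      ((continuous_localGibbs hq hχ (box d n) ξ).comp hJ)).measurable)
    (fun k => ‖F k‖) (fun k n J => (F k).norm_coe_le_norm _)
  let D : ℕ → Finset (Site d) := fun n => box d (φ n)
  have hD : IsCofinalSeq D := isCofinalSeq_box_comp d hφ
  have hconv : ∀ᵐ J : Couplings q w ∂ν, ∃ m : StateLaw d,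
      Tendsto (fun N : ℕ => empiricalMetastate hq hχ D ξ N J) atTop (𝓝 m) := by
    filter_upwards [hlim] with J hJlim
    -- The compact set may depend on `J`; only the test functions `F` and the subsequence must not.
    obtain ⟨C, hC, hmem⟩ := localGibbs_mem_momentSet hq hχ hw J hξ
    have hK := isCompact_momentSet hp0 hw hC
    refine exists_tendsto_of_tendsto_integral hF hK
      (fun N => empiricalMetastate hq hχ D ξ N J) (fun N => ?_) fun k => ?_
    · refine (empiricalMetastate_apply hq hχ D ξ N J hK.measurableSet.compl).trans ?_
      simp [hmem]
    · obtain ⟨l, hl⟩ := hJlim k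
      refine ⟨l, (hl.comp (tendsto_add_atTop_nat 1)).congr fun N => ?_⟩
      exact (integral_empiricalMetastate hq hχ D ξ N J (F k)).symm
  -- Limits exist only almost everywhere; this selects a version that is measurable on all of
  -- `Couplings q w`.
  obtain ⟨m, hm, hmlim⟩ := measurable_limit_of_tendsto_metrizable_ae
    (fun N => ((continuous_empiricalMetastate hq hχ D ξ N).comp hJ).measurable.aemeasurable) hconv
  have hgibbs : ∀ᵐ J : Couplings q w ∂ν,
      ∀ᵐ μ ∂(m J).toMeasure, μ ∈ gibbsStates (2 * q / (q - 1)) w χ J := by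
    filter_upwards [hmlim] with J hJlim
    exact ae_mem_gibbsStates_of_tendsto_empiricalMetastate hq hχ hw hD hξ J hJlim
  refine ⟨m, D, ⟨hm, ?_, fun J => barycentre (m J), fun J f => integral_barycentre (m J) f,
    continuous_barycentre.measurable.comp hm, ?_⟩, hD, hmlim⟩
  · filter_upwards [hgibbs] with J hJm
    -- Almost sure membership gives measure one without measurability of the set of Gibbs states.
    exact (measure_congr (eventuallyEq_univ.2 hJm)).trans measure_univ
  · filter_upwards [hgibbs] with J hJm
    exact barycentre_mem_gibbsStates hw hq hχ hJm
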